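/- Let $R=\bigoplus_{n\ge 0}R_n$ be a Noetherian commutative $\mathbb{N}_0$-graded ring which is homogeneous, i.e. generated as an $R_0$-algebra by $R_1$, and whose base ring $(R_0,\mathfrak{m}_0)$ is local. Let $R_+=\bigoplus_{n>0}R_n$, let $\mathfrak{q}_0\subseteq R_0$ be an $\mathfrak{m}_0$-primary ideal, and let $M=\bigoplus_{n\in\mathbb{Z}}M_n$ be a finitely generated graded $R$-module. Let $$R_0''\xleftarrow{\;g_0\;}R_0'\xrightarrow{\;f_0\;}R_0$$ be homomorphisms of Noetherian local rings such that $f_0$ is surjective, $g_0$ is flat, and the maximal ideal of $R_0''$ is generated by the image under $g_0$ of the maximal ideal of $R_0'$. Regard $R\otimes_{R_0'}R_0''$ as a graded ring and $M\otimes_{R_0'}R_0''$ as a graded module over it, with components $R_n\otimes_{R_0'}R_0''$ and $M_n\otimes_{R_0'}R_0''$, and regard $R_+\otimes_{R_0'}R_0''$ as an ideal of $R\otimes_{R_0'}R_0''$. Then for all $i\in\mathbb{N}_0$ and all $n\in\mathbb{Z}$, $$e_{\mathfrak{q}_0}\bigl(H^i_{R_+}(M)_n\bigr)=e_{f_0^{-1}(\mathfrak{q}_0)R_0''}\bigl(H^i_{R_+\otimes_{R_0'}R_0''}(M\otimes_{R_0'}R_0'')_n\bigr).$$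 Here, for a homogeneous ideal $J$, $H^i_J(-)_n$ denotes the degree-$n$ component of the $i$-th graded local cohomology module, i.e. the $i$-th right derived functor of $X\mapsto\Gamma_J(X)_n$ on graded modules, where $\Gamma_J(X)=\{x\in X: J^tx=0 \text{ for some } t\}$; the two components in the formula are regarded as modules over $R_0$ and over $R_0''$, respectively. For a Noetherian local ring $A$, an ideal $\mathfrak{q}$ primary to its maximal ideal and a finitely generated $A$-module $T$, $e_{\mathfrak{q}}(T)=d!\,c$ denotes the Hilbert-Samuel multiplicity, where $d$ is the degree and $c$ the leading coefficient of the polynomial $P$ with $P(m)=\operatorname{length}_A(T/\mathfrak{q}^{m+1}T)$ for all large $m$ (and $e_{\mathfrak{q}}(0)=0$). -/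

import Mathlib

open scoped TensorProduct

universe u

/-- A criterion for a family of submodules to be a direct sum decomposition. -/
theorem isInternal_of_proj {k V : Type*} [CommRing k] [AddCommGroup V] [Module k V]
    (W : ℤ → Submodule k V) (p : ℤ → V →ₗ[k] V) (hself : ∀ n, ∀ x ∈ W n, p n x = x)
    (hne : ∀ m n, m ≠ n → ∀ x ∈ W n, p m x = 0) (htop : ⨆ n, W n = ⊤) :
    DirectSum.IsInternal W := by
  rw [DirectSum.isInternal_submodule_iff_iSupIndep_and_iSup_eq_top]
  refine ⟨fun n => ?_, htop⟩
  rw [Submodule.disjoint_def]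
  intro x hx hx'
  have hle : (⨆ j, ⨆ (_ : j ≠ n), W j) ≤ LinearMap.ker (p n) :=
    iSup₂_le fun j hj y hy => hne n j hj.symm y hy
  rw [← hself n x hx]
  exact hle hx'

/-- A `ℤ`-graded module over the `ℕ`-graded `k`-algebra `(R, 𝒜)`. -/
structure ZGradedModule {k R : Type u} [CommRing k] [CommRing R] [Algebra k R]
    (𝒜 : ℕ → Submodule k R) where
  carrier : Type u
  [addCommGroup : AddCommGroup carrier]
  [moduleBase : Module k carrier]
  [module : Module R carrier]
  [isScalarTower : IsScalarTower k R carrier]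
  /-- The homogeneous component of degree `n`. -/
  deg : ℤ → Submodule k carrier
  isInternal : DirectSum.IsInternal deg
  smul_mem : ∀ {a : ℕ} {n : ℤ} {r : R} {x : carrier},
    r ∈ 𝒜 a → x ∈ deg n → r • x ∈ deg (a + n)

namespace ZGradedModule

section Basic

variable {k R : Type u} [CommRing k] [CommRing R] [Algebra k R] {𝒜 : ℕ → Submodule k R}

instance : CoeSort (ZGradedModule 𝒜) (Type u) := ⟨carrier⟩

attribute [instance] addCommGroup moduleBase module isScalarTower

/-- An `R`-linear map is graded if it preserves degrees. -/
def IsGradedMap {X Y : ZGradedModule 𝒜} (f : X →ₗ[R] Y) : Prop :=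
  ∀ n, ∀ x ∈ X.deg n, f x ∈ Y.deg n

/-- `E` is an injective object of the category of graded `R`-modules and graded maps. -/
def IsGradedInjective (E : ZGradedModule 𝒜) : Prop :=
  ∀ (X Y : ZGradedModule 𝒜) (j : X →ₗ[R] Y) (φ : X →ₗ[R] E),
    IsGradedMap j → Function.Injective j → IsGradedMap φ →
      ∃ ψ : Y →ₗ[R] E, IsGradedMap ψ ∧ ψ ∘ₗ j = φ

/-- An injective resolution `0 → M → E⁰ → E¹ → ⋯` in the category of graded `R`-modules. -/
structure InjectiveResolution (M : ZGradedModule 𝒜) where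
  obj : ℕ → ZGradedModule 𝒜
  injective : ∀ i, (obj i).IsGradedInjective
  ι : M →ₗ[R] obj 0
  ι_graded : IsGradedMap ι
  ι_injective : Function.Injective ι
  d : ∀ i, obj i →ₗ[R] obj (i + 1)
  d_graded : ∀ i, IsGradedMap (d i)
  exact_zero : Function.Exact ι (d 0)
  exact_succ : ∀ i, Function.Exact (d i) (d (i + 1))

/-- The degree `n` component of the `J`-torsion module `Γ_J(X) = {x | ∃ t, J ^ t • x = 0}`. -/
def torsionDeg (J : Ideal R) (X : ZGradedModule 𝒜) (n : ℤ) : Submodule k X where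
  carrier := {x | x ∈ X.deg n ∧ ∃ t : ℕ, ∀ r ∈ J ^ t, r • x = 0}
  zero_mem' := ⟨zero_mem _, 0, fun r _ => smul_zero r⟩
  add_mem' := by
    rintro x y ⟨hx, s, hs⟩ ⟨hy, t, ht⟩
    refine ⟨add_mem hx hy, s + t, fun r hr => ?_⟩
    rw [smul_add, hs r (Ideal.pow_le_pow_right (Nat.le_add_right s t) hr),
      ht r (Ideal.pow_le_pow_right (Nat.le_add_left t s) hr), add_zero]
  smul_mem' := by
    rintro c x ⟨hx, t, ht⟩
    refine ⟨Submodule.smul_mem _ c hx, t, fun r hr => ?_⟩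
    rw [← algebraMap_smul R c x, smul_comm, ht r hr, smul_zero]

namespace InjectiveResolution

variable {M : ZGradedModule 𝒜} (E : InjectiveResolution M) (J : Ideal R)

/-- The cocycles of the complex `Γ_J(E)ₙ` of `k`-modules. -/
def cocycles (i : ℕ) (n : ℤ) : Submodule k (E.obj i) :=
  torsionDeg J (E.obj i) n ⊓ LinearMap.ker ((E.d i).restrictScalars k)

/-- The coboundaries of the complex `Γ_J(E)ₙ` of `k`-modules. -/
def coboundaries : (i : ℕ) → (n : ℤ) → Submodule k (E.obj i)
  | 0, _ => ⊥
  | i + 1, n => (torsionDeg J (E.obj i) n).map ((E.d i).restrictScalars k)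

/-- The `i`-th cohomology of the complex `Γ_J(E)ₙ` of `k`-modules. -/
abbrev cohomology (i : ℕ) (n : ℤ) : Type u :=
  E.cocycles J i n ⧸ (E.coboundaries J i n).submoduleOf (E.cocycles J i n)

end InjectiveResolution

/-- The decomposition of an element into its homogeneous components. -/
noncomputable def decomp (X : ZGradedModule 𝒜) : X ≃ₗ[k] DirectSum ℤ fun n => X.deg n :=
  (LinearEquiv.ofBijective (DirectSum.coeLinearMap X.deg)
    (show Function.Bijective (DirectSum.coeLinearMap X.deg) from X.isInternal)).symm

theorem decomp_of_mem (X : ZGradedModule 𝒜) (n : ℤ) (x : X) (hx : x ∈ X.deg n) :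
    X.decomp x = DirectSum.lof k ℤ (fun n => X.deg n) n ⟨x, hx⟩ := by
  refine (LinearEquiv.symm_apply_eq _).2 ?_
  exact (DirectSum.coeLinearMap_lof X.deg n ⟨x, hx⟩).symm

/-- The projection onto the component of degree `n`. -/
noncomputable def proj (X : ZGradedModule 𝒜) (n : ℤ) : X →ₗ[k] X :=
  (X.deg n).subtype ∘ₗ DirectSum.component k ℤ (fun n => X.deg n) n ∘ₗ X.decomp.toLinearMap

theorem proj_self (X : ZGradedModule 𝒜) (n : ℤ) (x : X) (hx : x ∈ X.deg n) : X.proj n x = x := by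
  simp only [proj, LinearMap.comp_apply, LinearEquiv.coe_coe, X.decomp_of_mem n x hx,
    DirectSum.component.lof_self, Submodule.subtype_apply]

theorem proj_ne (X : ZGradedModule 𝒜) (m n : ℤ) (hmn : m ≠ n) (x : X) (hx : x ∈ X.deg n) :
    X.proj m x = 0 := by
  simp only [proj, LinearMap.comp_apply, LinearEquiv.coe_coe, X.decomp_of_mem n x hx,
    DirectSum.component.of]
  rw [dif_neg hmn.symm, map_zero]

theorem proj_mem (X : ZGradedModule 𝒜) (n : ℤ) (x : X) : X.proj n x ∈ X.deg n :=
  Subtype.prop _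

theorem iSup_deg (X : ZGradedModule 𝒜) : ⨆ n, X.deg n = ⊤ :=
  X.isInternal.submodule_iSup_eq_top

theorem iSup_map_deg {V : Type*} [AddCommGroup V] [Module k V] (X : ZGradedModule 𝒜)
    (π : X →ₗ[k] V) (hπ : Function.Surjective π) : ⨆ n, (X.deg n).map π = ⊤ := by
  rw [← Submodule.map_iSup, iSup_deg, Submodule.map_top, LinearMap.range_eq_top]
  exact hπ

/-- Two `k`-linear maps that agree on homogeneous elements are equal. -/
theorem hom_ext {V : Type*} [AddCommGroup V] [Module k V] (X : ZGradedModule 𝒜)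
    (f g : X →ₗ[k] V) (h : ∀ n, ∀ x ∈ X.deg n, f x = g x) (x : X) : f x = g x := by
  have hle : (⨆ n, X.deg n) ≤ LinearMap.eqLocus f g := iSup_le fun n y hy => h n y hy
  rw [iSup_deg] at hle
  exact hle trivial

/-- A `k`-linear endomorphism that preserves the kernel of a surjection descends. -/
theorem exists_descent {V Q : Type*} [AddCommGroup V] [Module k V] [AddCommGroup Q] [Module k Q]
    (π : V →ₗ[k] Q) (hπ : Function.Surjective π) (g : V →ₗ[k] V)
    (hg : ∀ x, π x = 0 → π (g x) = 0) : ∃ p : Q →ₗ[k] Q, ∀ x, p (π x) = π (g x) := by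
  have hle : LinearMap.ker π ≤ LinearMap.ker (π ∘ₗ g) := fun x hx => hg x hx
  refine ⟨(LinearMap.ker π).liftQ (π ∘ₗ g) hle ∘ₗ
    (π.quotKerEquivOfSurjective hπ).symm.toLinearMap, fun x => ?_⟩
  have hx : (π.quotKerEquivOfSurjective hπ).symm (π x) = (LinearMap.ker π).mkQ x := by
    rw [LinearEquiv.symm_apply_eq]
    rfl
  rw [LinearMap.comp_apply, LinearEquiv.coe_coe, hx, Submodule.mkQ_apply, Submodule.liftQ_apply,
    LinearMap.comp_apply]

/-- The image of a graded module under a surjection whose kernel is a graded submodule. -/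
def ofSurjective (Y : ZGradedModule 𝒜) (Q : Type u) [AddCommGroup Q] [Module k Q] [Module R Q]
    [IsScalarTower k R Q] (π : Y →ₗ[R] Q) (hπ : Function.Surjective π)
    (hker : ∀ y, π y = 0 → ∀ n, π (Y.proj n y) = 0) : ZGradedModule 𝒜 where
  carrier := Q
  deg n := (Y.deg n).map (π.restrictScalars k)
  isInternal := by
    choose p hp using fun n => exists_descent (π.restrictScalars k) hπ (Y.proj n)
      (fun y hy => hker y hy n)
    refine isInternal_of_proj _ p ?_ ?_ (Y.iSup_map_deg _ hπ)
    · rintro n _ ⟨y, hy, rfl⟩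
      rw [hp, Y.proj_self n y hy]
    · rintro m n hmn _ ⟨y, hy, rfl⟩
      rw [hp, Y.proj_ne m n hmn y hy, map_zero]
  smul_mem := by
    rintro a n r _ hr ⟨y, hy, rfl⟩
    exact ⟨r • y, Y.smul_mem hr hy, map_smul π r y⟩

theorem proj_map {X Y : ZGradedModule 𝒜} (f : X →ₗ[R] Y) (hf : IsGradedMap f) (n : ℤ) (x : X) :
    Y.proj n (f x) = f (X.proj n x) := by
  refine X.hom_ext (Y.proj n ∘ₗ f.restrictScalars k) (f.restrictScalars k ∘ₗ X.proj n) ?_ x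
  intro m y hy
  by_cases hnm : n = m
  · subst hnm
    simp [X.proj_self n y hy, Y.proj_self n _ (hf n y hy)]
  · simp [X.proj_ne n m hnm y hy, Y.proj_ne n m hnm _ (hf m y hy)]

/-- The cokernel of a graded map. -/
def coker {X Y : ZGradedModule 𝒜} (f : X →ₗ[R] Y) (hf : IsGradedMap f) : ZGradedModule 𝒜 :=
  Y.ofSurjective (Y ⧸ LinearMap.range f) (LinearMap.range f).mkQ (Submodule.mkQ_surjective _) (by
    intro y hy n
    rw [Submodule.mkQ_apply, Submodule.Quotient.mk_eq_zero] at hy ⊢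
    obtain ⟨x, rfl⟩ := hy
    exact ⟨X.proj n x, (proj_map f hf n x).symm⟩)

/-- The projection onto the cokernel. -/
def cokerMap {X Y : ZGradedModule 𝒜} (f : X →ₗ[R] Y) (hf : IsGradedMap f) :
    Y →ₗ[R] coker f hf := (LinearMap.range f).mkQ

theorem cokerMap_graded {X Y : ZGradedModule 𝒜} (f : X →ₗ[R] Y) (hf : IsGradedMap f) :
    IsGradedMap (cokerMap f hf) := fun _ y hy => ⟨y, hy, rfl⟩

theorem cokerMap_exact {X Y : ZGradedModule 𝒜} (f : X →ₗ[R] Y) (hf : IsGradedMap f) :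
    Function.Exact f (cokerMap f hf) := LinearMap.exact_map_mkQ_range f

theorem cokerMap_surjective {X Y : ZGradedModule 𝒜} (f : X →ₗ[R] Y) (hf : IsGradedMap f) :
    Function.Surjective (cokerMap f hf) := Submodule.mkQ_surjective _

end Basic

section Coinduced

variable {k R : Type u} [CommRing k] [CommRing R] [Algebra k R] (𝒜 : ℕ → Submodule k R)
variable (N : Type u) [AddCommGroup N] [Module k N]

/-- The module `N[T, T⁻¹]`, on which `r` of degree `a` acts as multiplication by `r T ^ a`. -/
@[nolint unusedArguments]
def Laurent (_𝒜 : ℕ → Submodule k R) (N : Type u) [AddCommGroup N] : Type u := ℤ →₀ N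

noncomputable instance : AddCommGroup (Laurent 𝒜 N) := inferInstanceAs (AddCommGroup (ℤ →₀ N))

noncomputable instance : Module k (Laurent 𝒜 N) := inferInstanceAs (Module k (ℤ →₀ N))

/-- The monomial `x T ^ n`. -/
noncomputable def Laurent.mono (n : ℤ) : N →ₗ[k] Laurent 𝒜 N := Finsupp.lsingle n

/-- The coefficient of `T ^ n`. -/
noncomputable def Laurent.coeff (n : ℤ) : Laurent 𝒜 N →ₗ[k] N := Finsupp.lapply n

/-- Evaluation at `T = 1`. -/
noncomputable def Laurent.eval : Laurent 𝒜 N →ₗ[k] N := Finsupp.lsum k fun _ => LinearMap.id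

variable {𝒜 N} in
theorem Laurent.hom_ext {V : Type*} [AddCommGroup V] [Module k V] {f g : Laurent 𝒜 N →ₗ[k] V}
    (h : ∀ n x, f (Laurent.mono 𝒜 N n x) = g (Laurent.mono 𝒜 N n x)) : f = g :=
  Finsupp.lhom_ext h

theorem Laurent.eval_mono (n : ℤ) (x : N) : eval 𝒜 N (mono 𝒜 N n x) = x := by
  exact (Finsupp.lsum_single k (fun _ : ℤ => (LinearMap.id : N →ₗ[k] N)) n x).trans rfl

theorem Laurent.coeff_mono_self (n : ℤ) (x : N) : coeff 𝒜 N n (mono 𝒜 N n x) = x := by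
  exact Finsupp.single_eq_same

theorem Laurent.coeff_mono_ne (m n : ℤ) (h : m ≠ n) (x : N) :
    coeff 𝒜 N m (mono 𝒜 N n x) = 0 := by
  exact Finsupp.single_eq_of_ne h

theorem Laurent.iSup_range : ⨆ n, LinearMap.range (mono 𝒜 N n) = ⊤ :=
  Finsupp.iSup_lsingle_range (R := k) (M := N)

variable [Module R N] [IsScalarTower k R N]

/-- The action of an element `r`, regarded as an element of degree `a`. -/
noncomputable def Laurent.actElt (a : ℕ) (r : R) : Module.End k (Laurent 𝒜 N) :=
  Finsupp.lsum k fun n => Laurent.mono 𝒜 N (a + n) ∘ₗ Module.toModuleEnd k (S := R) N r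

theorem Laurent.actElt_mono (a : ℕ) (r : R) (n : ℤ) (x : N) :
    actElt 𝒜 N a r (mono 𝒜 N n x) = mono 𝒜 N (a + n) (r • x) :=
  (Finsupp.lsum_single k (fun n : ℤ =>
    Laurent.mono 𝒜 N (a + n) ∘ₗ Module.toModuleEnd k (S := R) N r) n x).trans rfl

/-- The action of the elements of degree `a`. -/
noncomputable def Laurent.act (a : ℕ) : 𝒜 a →ₗ[k] Module.End k (Laurent 𝒜 N) where
  toFun r := actElt 𝒜 N a r
  map_add' r s := Laurent.hom_ext fun n x => by
    rw [LinearMap.add_apply, actElt_mono, actElt_mono, actElt_mono, ← map_add, ← add_smul,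
      Submodule.coe_add]
  map_smul' c r := Laurent.hom_ext fun n x => by
    rw [RingHom.id_apply, LinearMap.smul_apply, actElt_mono, actElt_mono, ← map_smul,
      Submodule.coe_smul, smul_assoc]

theorem Laurent.act_mono (a : ℕ) (r : 𝒜 a) (n : ℤ) (x : N) :
    act 𝒜 N a r (mono 𝒜 N n x) = mono 𝒜 N (a + n) ((r : R) • x) :=
  actElt_mono 𝒜 N a r n x

variable [GradedAlgebra 𝒜]

theorem Laurent.act_one :
    act 𝒜 N 0 (GradedMonoid.GOne.one (A := fun a => 𝒜 a)) = 1 := Laurent.hom_ext fun n x => by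
  rw [act_mono]
  simp

theorem Laurent.act_mul {a b : ℕ} (r : 𝒜 a) (s : 𝒜 b) :
    act 𝒜 N (a + b) (GradedMonoid.GMul.mul (A := fun a => 𝒜 a) r s) = act 𝒜 N a r * act 𝒜 N b s :=
  Laurent.hom_ext fun n x => by
    rw [Module.End.mul_apply, act_mono, act_mono, act_mono]
    simp [mul_smul, add_assoc]

/-- The action of `R` on `N[T, T⁻¹]`. -/
noncomputable def Laurent.actHom : R →ₐ[k] Module.End k (Laurent 𝒜 N) :=
  (DirectSum.toAlgebra k (fun a => 𝒜 a) (Laurent.act 𝒜 N) (act_one 𝒜 N) (act_mul 𝒜 N)).comp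
    (DirectSum.decomposeAlgEquiv 𝒜).toAlgHom

noncomputable instance : Module R (Laurent 𝒜 N) :=
  Module.compHom (Laurent 𝒜 N) (Laurent.actHom 𝒜 N).toRingHom

theorem Laurent.smul_def (r : R) (x : Laurent 𝒜 N) : r • x = actHom 𝒜 N r x := rfl

theorem Laurent.smul_mono {a : ℕ} {r : R} (hr : r ∈ 𝒜 a) (n : ℤ) (x : N) :
    r • mono 𝒜 N n x = mono 𝒜 N (a + n) (r • x) := by
  rw [smul_def]
  lift r to 𝒜 a using hr
  refine Eq.trans (congrArg (fun g : Module.End k (Laurent 𝒜 N) => g (mono 𝒜 N n x)) ?_)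
    (act_mono 𝒜 N a r n x)
  change DirectSum.toAlgebra k (fun a => 𝒜 a) (act 𝒜 N) (act_one 𝒜 N) (act_mul 𝒜 N) (DirectSum.decompose 𝒜 (r : R)) = _
  rw [DirectSum.decompose_coe]
  exact DirectSum.toSemiring_of (fun a => (act 𝒜 N a).toAddMonoidHom) (act_one 𝒜 N)
    (act_mul 𝒜 N) a r

instance : IsScalarTower k R (Laurent 𝒜 N) where
  smul_assoc c r x := by
    rw [Laurent.smul_def, Laurent.smul_def, map_smul, LinearMap.smul_apply]

/-- The graded module `N[T, T⁻¹]`. -/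
noncomputable def coinduced : ZGradedModule 𝒜 where
  carrier := Laurent 𝒜 N
  deg n := LinearMap.range (Laurent.mono 𝒜 N n)
  isInternal := by
    refine isInternal_of_proj _ (fun n => Laurent.mono 𝒜 N n ∘ₗ Laurent.coeff 𝒜 N n) ?_ ?_
      (Laurent.iSup_range 𝒜 N)
    · rintro n _ ⟨x, rfl⟩
      simp [Laurent.coeff_mono_self]
    · rintro m n hmn _ ⟨x, rfl⟩
      simp [Laurent.coeff_mono_ne 𝒜 N m n hmn]
  smul_mem := by
    rintro a n r _ hr ⟨x, rfl⟩
    exact ⟨r • x, (Laurent.smul_mono 𝒜 N hr n x).symm⟩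

variable {𝒜 N}

/-- Additive induction on the homogeneous components of a ring element. -/
theorem ring_induction {P : R → Prop} (h0 : P 0) (hadd : ∀ r s, P r → P s → P (r + s))
    (hhom : ∀ a, ∀ r ∈ 𝒜 a, P r) (r : R) : P r :=
  DirectSum.Decomposition.inductionOn 𝒜 h0 (fun {a} r => hhom a r r.2) hadd r

/-- Evaluation at `T = 1` is `R`-linear. -/
noncomputable def evalHomAux : Laurent 𝒜 N →ₗ[R] N where
  toFun := Laurent.eval 𝒜 N
  map_add' := map_add _
  map_smul' r x := by
    refine ring_induction (𝒜 := 𝒜) (P := fun r => Laurent.eval 𝒜 N (r • x) =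
      r • Laurent.eval 𝒜 N x) ?_ ?_ ?_ r
    · rw [zero_smul, zero_smul, map_zero]
    · intro r s hr hs
      rw [add_smul, add_smul, map_add, hr, hs]
    · intro a r hr
      have h : Laurent.eval 𝒜 N ∘ₗ Laurent.actHom 𝒜 N r =
          Module.toModuleEnd k (S := R) N r ∘ₗ Laurent.eval 𝒜 N := by
        refine Laurent.hom_ext fun n y => ?_
        change Laurent.eval 𝒜 N (r • Laurent.mono 𝒜 N n y) = r • Laurent.eval 𝒜 N _
        rw [Laurent.smul_mono 𝒜 N hr, Laurent.eval_mono, Laurent.eval_mono]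
      exact LinearMap.congr_fun h x

/-- Evaluation at `T = 1` on the graded module `N[T, T⁻¹]`. -/
noncomputable def evalHom : coinduced 𝒜 N →ₗ[R] N := evalHomAux

/-- The map `x ↦ ∑ₙ h(xₙ) T ^ n`, as a `k`-linear map. -/
noncomputable def liftAux {X : ZGradedModule 𝒜} (h : X →ₗ[R] N) : X →ₗ[k] Laurent 𝒜 N :=
  DirectSum.toModule k ℤ (Laurent 𝒜 N)
      (fun n => Laurent.mono 𝒜 N n ∘ₗ h.restrictScalars k ∘ₗ (X.deg n).subtype) ∘ₗ
    X.decomp.toLinearMap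

theorem liftAux_of_mem {X : ZGradedModule 𝒜} (h : X →ₗ[R] N) (n : ℤ) (x : X)
    (hx : x ∈ X.deg n) : liftAux h x = Laurent.mono 𝒜 N n (h x) := by
  simp only [liftAux, LinearMap.comp_apply, LinearEquiv.coe_coe, X.decomp_of_mem n x hx,
    DirectSum.toModule_lof, Submodule.subtype_apply, LinearMap.restrictScalars_apply]

/-- The graded map `x ↦ ∑ₙ h(xₙ) T ^ n` into `N[T, T⁻¹]` given by an `R`-linear map `h`. -/
noncomputable def lift {X : ZGradedModule 𝒜} (h : X →ₗ[R] N) : X →ₗ[R] coinduced 𝒜 N where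
  toFun := liftAux h
  map_add' := map_add _
  map_smul' r x := by
    refine ring_induction (𝒜 := 𝒜) (P := fun r => liftAux h (r • x) = r • liftAux h x) ?_ ?_ ?_ r
    · rw [zero_smul, zero_smul, map_zero]
    · intro r s hr hs
      rw [add_smul, add_smul, map_add, hr, hs]
    · intro a r hr
      refine X.hom_ext (liftAux h ∘ₗ Module.toModuleEnd k (S := R) X r)
        (Laurent.actHom 𝒜 N r ∘ₗ liftAux h) ?_ x
      intro n y hy
      change liftAux h (r • y) = r • liftAux h y
      rw [liftAux_of_mem h n y hy, liftAux_of_mem h _ _ (X.smul_mem hr hy),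
        Laurent.smul_mono 𝒜 N hr, map_smul]

theorem lift_of_mem {X : ZGradedModule 𝒜} (h : X →ₗ[R] N) (n : ℤ) (x : X)
    (hx : x ∈ X.deg n) : lift h x = Laurent.mono 𝒜 N n (h x) :=
  liftAux_of_mem h n x hx

theorem lift_graded {X : ZGradedModule 𝒜} (h : X →ₗ[R] N) : IsGradedMap (lift h) :=
  fun n x hx => ⟨h x, (lift_of_mem h n x hx).symm⟩

theorem evalHom_lift {X : ZGradedModule 𝒜} (h : X →ₗ[R] N) (x : X) : evalHom (lift h x) = h x := by
  refine X.hom_ext (Laurent.eval 𝒜 N ∘ₗ liftAux h) (h.restrictScalars k) ?_ x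
  intro n y hy
  change Laurent.eval 𝒜 N (liftAux h y) = h y
  rw [liftAux_of_mem h n y hy, Laurent.eval_mono]

theorem lift_injective {X : ZGradedModule 𝒜} (h : X →ₗ[R] N) (hh : Function.Injective h) :
    Function.Injective (lift h) := fun x y hxy => hh <| by
  rw [← evalHom_lift h x, hxy, evalHom_lift]

theorem coinduced_injective [Module.Injective R N] : (coinduced 𝒜 N).IsGradedInjective := by
  intro X Y j φ hj hj' hφ
  obtain ⟨ψ, hψ⟩ := Module.Injective.out j hj' (evalHom ∘ₗ φ)
  refine ⟨lift ψ, lift_graded ψ, LinearMap.ext fun x => ?_⟩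
  refine X.hom_ext ((lift ψ ∘ₗ j).restrictScalars k) (φ.restrictScalars k) ?_ x
  intro n y hy
  change lift ψ (j y) = φ y
  obtain ⟨z, hz⟩ := hφ n y hy
  rw [lift_of_mem ψ n _ (hj n y hy), hψ y, ← hz]
  change Laurent.mono 𝒜 N n (evalHom (φ y)) = _
  rw [← hz]
  exact congrArg _ (Laurent.eval_mono 𝒜 N n z)

end Coinduced

section LocalCohomology

variable {k R : Type u} [CommRing k] [CommRing R] [Algebra k R] {𝒜 : ℕ → Submodule k R}
  [GradedAlgebra 𝒜]

theorem exists_injective_embedding (X : ZGradedModule 𝒜) :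
    ∃ (E : ZGradedModule 𝒜) (f : X →ₗ[R] E),
      E.IsGradedInjective ∧ IsGradedMap f ∧ Function.Injective f := by
  obtain ⟨⟨I, hI, f, hf⟩⟩ :=
    (inferInstance : CategoryTheory.EnoughInjectives (ModuleCat.{u} R)).presentation
      (ModuleCat.of R X)
  have hinj : Module.Injective R I := Module.injective_module_of_injective_object R I
  let _ : Module k I := Module.compHom I (algebraMap k R)
  have : IsScalarTower k R I := .of_algebraMap_smul fun _ _ => rfl
  exact ⟨coinduced 𝒜 I, lift f.hom, coinduced_injective, lift_graded _,
    lift_injective _ ((ModuleCat.mono_iff_injective f).1 hf)⟩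

/-- Every graded module has a graded injective resolution. -/
theorem nonempty_injectiveResolution (M : ZGradedModule 𝒜) :
    Nonempty (InjectiveResolution M) := by
  choose E f hE hf hf' using exists_injective_embedding (𝒜 := 𝒜)
  let X : ℕ → ZGradedModule 𝒜 := fun i => Nat.rec M (fun _ Y => coker (f Y) (hf Y)) i
  let π : ∀ i, E (X i) →ₗ[R] X (i + 1) := fun i => cokerMap (f (X i)) (hf (X i))
  have hπ : ∀ i, Function.Exact (f (X i)) (π i) := fun i => cokerMap_exact (f (X i)) (hf (X i))
  have hπs : ∀ i, Function.Surjective (π i) := fun i => cokerMap_surjective (f (X i)) (hf (X i))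
  have hex : ∀ i, Function.Exact (f (X i)) (f (X (i + 1)) ∘ₗ π i) := fun i x => by
    rw [← hπ i x, LinearMap.comp_apply, map_eq_zero_iff _ (hf' _)]
  exact ⟨{
    obj := fun i => E (X i)
    injective := fun i => hE _
    ι := f M
    ι_graded := hf M
    ι_injective := hf' M
    d := fun i => f (X (i + 1)) ∘ₗ π i
    d_graded := fun i n x hx => hf (X (i + 1)) n _ (cokerMap_graded (f (X i)) (hf (X i)) n x hx)
    exact_zero := hex 0
    exact_succ := fun i x => by
      rw [hex (i + 1) x]
      constructor
      · rintro ⟨y, rfl⟩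
        obtain ⟨z, rfl⟩ := hπs i y
        exact ⟨z, rfl⟩
      · rintro ⟨z, rfl⟩
        exact ⟨π i z, rfl⟩ }⟩

/-- The component `H^i_J(M)ₙ` of degree `n` of the `i`-th local cohomology module of the graded
module `M` with respect to the homogeneous ideal `J`: the value at `M` of the `i`-th right derived
functor of `Γ_J(-)ₙ` on graded modules, computed from an injective resolution. -/
abbrev localCohomology (M : ZGradedModule 𝒜) (J : Ideal R) (i : ℕ) (n : ℤ) : Type u :=
  (Classical.choice M.nonempty_injectiveResolution).cohomology J i n

end LocalCohomology

section BaseChange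

variable {k R : Type u} [CommRing k] [CommRing R] [Algebra k R]
variable (A : Type u) [CommRing A] [Algebra A k] [Algebra A R] [IsScalarTower A k R]
variable (S : Type u) [CommRing S] [Algebra A S]

/-- The grading of `S ⊗[A] R` whose component of degree `a` is the image of `S ⊗[A] 𝒜 a`. -/
def baseChangeGrading (𝒜 : ℕ → Submodule k R) (a : ℕ) : Submodule S (S ⊗[A] R) :=
  ((𝒜 a).restrictScalars A).baseChange S

noncomputable instance (𝒜 : ℕ → Submodule k R) [GradedAlgebra 𝒜] :
    GradedAlgebra (fun a => (𝒜 a).restrictScalars A) where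
  one_mem := SetLike.GradedOne.one_mem (A := 𝒜)
  mul_mem _ _ _ _ h h' := SetLike.GradedMul.mul_mem (A := 𝒜) h h'
  decompose' := DirectSum.Decomposition.decompose' (ℳ := 𝒜)
  left_inv := DirectSum.Decomposition.left_inv (ℳ := 𝒜)
  right_inv := DirectSum.Decomposition.right_inv (ℳ := 𝒜)

noncomputable instance (𝒜 : ℕ → Submodule k R) [GradedAlgebra 𝒜] :
    GradedAlgebra (baseChangeGrading A S 𝒜) :=
  GradedAlgebra.baseChange (S := S) (fun a => (𝒜 a).restrictScalars A)

/-- The action of `S ⊗[A] R` on `S ⊗[A] X` given by `(s ⊗ r) • (t ⊗ x) = s t ⊗ r x`. -/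
noncomputable def tensorAction (X : Type u) [AddCommGroup X] [Module A X] [Module R X]
    [IsScalarTower A R X] : S ⊗[A] R →ₐ[S] Module.End S (S ⊗[A] X) :=
  AlgHom.liftEquiv A S R _ ((Module.End.baseChangeHom A S X).comp (Algebra.lsmul A A X))

theorem tensorAction_tmul (X : Type u) [AddCommGroup X] [Module A X] [Module R X]
    [IsScalarTower A R X] (s t : S) (r : R) (x : X) :
    tensorAction A S X (s ⊗ₜ r) (t ⊗ₜ x) = (s * t) ⊗ₜ (r • x) := by
  rfl

/-- The graded `S ⊗[A] R`-module `S ⊗[A] X` obtained from the graded `R`-module `X`. -/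
noncomputable def baseChange {𝒜 : ℕ → Submodule k R} (X : ZGradedModule 𝒜) [Module A X]
    [IsScalarTower A k X] : ZGradedModule (baseChangeGrading A S 𝒜) :=
  haveI : IsScalarTower A R X := .of_algebraMap_smul fun c x => by
    rw [IsScalarTower.algebraMap_apply A k R, algebraMap_smul, algebraMap_smul]
  letI : Module (S ⊗[A] R) (S ⊗[A] X) :=
    Module.compHom (S ⊗[A] X) (tensorAction A S X).toRingHom
  { carrier := S ⊗[A] X
    isScalarTower := ⟨fun c r x => by
      change tensorAction A S X (c • r) x = c • tensorAction A S X r x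
      rw [map_smul, LinearMap.smul_apply]⟩
    deg := fun n => ((X.deg n).restrictScalars A).baseChange S
    isInternal := by
      refine isInternal_of_proj _
        (fun n => ((X.proj n).restrictScalars A).baseChange S) ?_ ?_ ?_
      · intro n x hx
        rw [Submodule.baseChange_eq_span] at hx
        induction hx using Submodule.span_induction with
        | mem x h =>
          obtain ⟨y, hy, rfl⟩ := h
          simp [X.proj_self n y hy]
        | zero => simp
        | add x y _ _ hx hy => rw [map_add, hx, hy]
        | smul c x _ hx => rw [map_smul, hx]
      · intro m n hmn x hx
        rw [Submodule.baseChange_eq_span] at hx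
        induction hx using Submodule.span_induction with
        | mem x h =>
          obtain ⟨y, hy, rfl⟩ := h
          simp [X.proj_ne m n hmn y hy]
        | zero => simp
        | add x y _ _ hx hy => rw [map_add, hx, hy, add_zero]
        | smul c x _ hx => rw [map_smul, hx, smul_zero]
      · rw [eq_top_iff]
        rintro x -
        induction x using TensorProduct.induction_on with
        | zero => exact zero_mem _
        | add x y hx hy => exact add_mem hx hy
        | tmul s x =>
          have hx : x ∈ ⨆ n, X.deg n := by rw [X.iSup_deg]; trivial
          induction hx using Submodule.iSup_induction' with
          | mem n x hx =>
            exact Submodule.mem_iSup_of_mem n (Submodule.tmul_mem_baseChange_of_mem s hx)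
          | zero => simp
          | add x y _ _ hx hy =>
            rw [TensorProduct.tmul_add]
            exact add_mem hx hy
    smul_mem := by
      intro a n r x hr hx
      change tensorAction A S X r x ∈ _
      rw [baseChangeGrading, Submodule.baseChange_eq_span] at hr
      rw [Submodule.baseChange_eq_span] at hx
      induction hr using Submodule.span_induction with
      | mem r h =>
        obtain ⟨r, hr, rfl⟩ := h
        induction hx using Submodule.span_induction with
        | mem x h =>
          obtain ⟨x, hx, rfl⟩ := h
          have h := tensorAction_tmul A S X 1 1 r x
          simp only [TensorProduct.mk_apply] at h ⊢
          rw [h]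
          exact Submodule.tmul_mem_baseChange_of_mem _ (X.smul_mem hr hx)
        | zero => rw [map_zero]; exact zero_mem _
        | add x y _ _ hx hy => rw [map_add]; exact add_mem hx hy
        | smul c x _ hx => rw [map_smul]; exact Submodule.smul_mem _ c hx
      | zero => rw [map_zero]; exact zero_mem _
      | add r s _ _ hr hs => rw [map_add]; exact add_mem hr hs
      | smul c r _ hr => rw [map_smul]; exact Submodule.smul_mem _ c hr }

end BaseChange

end ZGradedModule

section Multiplicity

variable {A : Type*} [CommRing A] (q : Ideal A) (T : Type*) [AddCommGroup T] [Module A T]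

/-- `P` is the Hilbert-Samuel polynomial of `T` with respect to `q`: the length of
`T / q ^ (m + 1) T` is finite and equal to `P(m)` for all large `m`. -/
def IsHilbertSamuelPolynomial (P : Polynomial ℚ) : Prop :=
  ∀ᶠ m : ℕ in Filter.atTop, ∃ l : ℕ,
    Module.length A (T ⧸ (q ^ (m + 1) • ⊤ : Submodule A T)) = l ∧ P.eval (m : ℚ) = l

open scoped Classical in
/-- The Hilbert-Samuel multiplicity `e_q(T) = d! c`, where `d` is the degree and `c` the leading
coefficient of the (unique) Hilbert-Samuel polynomial of `T` with respect to `q`; it is `0` for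
`T = 0`. A Hilbert-Samuel polynomial exists if `T` is finitely generated and `q` is primary to the
maximal ideal of the Noetherian local ring `A`. -/
noncomputable def hilbertSamuelMultiplicity : ℚ :=
  if h : ∃ P, IsHilbertSamuelPolynomial q T P then
    (h.choose.natDegree.factorial : ℚ) * h.choose.leadingCoeff
  else 0

end Multiplicity

/-!
For `J = (f₁, …, fᵣ)` in a Noetherian ring, call a module `J`-acyclic if for each `i` its
`(fᵢ₊₁, …, fᵣ)`-torsion is `fᵢ`-divisible up to `fᵢ`-power torsion. Let the `fᵢ` be homogeneous.
Graded injectives are `J`-acyclic: they are direct summands of modules of Laurent polynomials over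
injective modules, and an injective module is `J`-acyclic by the Artin–Rees lemma. Over an acyclic
kernel torsion elements lift along surjections, so `Γ_J` preserves exactness of bounded-below
sequences of acyclic modules. Applied to the mapping cone of a comparison map from an acyclic
resolution to an injective one, this shows that any acyclic resolution computes local cohomology.

Acyclicity is preserved by flat base change, while injectivity is not. Hence the base change of an
injective resolution of `M` computes the local cohomology of `S ⊗ M`, which is therefore the base
change of that of `M`. Finally, a flat local homomorphism `A → S` under which the maximal ideal of
`A` generates that of `S` preserves lengths, hence multiplicities.
-/

section Torsion

open scoped Pointwise

variable {R : Type*} [CommRing R]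

/-- The submodule of the elements that are annihilated by a power of each member of `l`, that is,
the `J`-torsion `Γ_J(X)` for `J = Ideal.ofList l`. -/
def powTorsion (l : List R) (X : Type*) [AddCommGroup X] [Module R X] : Submodule R X :=
  ⨅ f ∈ l, Submodule.torsion' R X (Submonoid.powers f)

/-- For `l = [f₁, …, fᵣ]`, the iterated local cohomology modules of `X` with respect to
`fᵣ, …, f₁` vanish in positive degrees. For a single element `f`, this means that the localization
map `Γ → Γ_f` is surjective, i.e. that `Γ` is `f`-divisible up to `f`-power torsion. -/
def IsTorsionAcyclic : (l : List R) → (X : Type*) → [AddCommGroup X] → [Module R X] → Prop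
  | [], _, _, _ => True
  | f :: l, X, _, _ =>
    IsTorsionAcyclic l X ∧ powTorsion l X ≤ f • powTorsion l X ⊔ powTorsion [f] X

variable {X Y Z : Type*} [AddCommGroup X] [Module R X] [AddCommGroup Y] [Module R Y]
  [AddCommGroup Z] [Module R Z] {f : R} {l : List R}

theorem mem_powTorsion {x : X} : x ∈ powTorsion l X ↔ ∀ f ∈ l, ∃ t : ℕ, f ^ t • x = 0 := by
  simp [powTorsion, Submonoid.smul_def, Submonoid.mem_powers_iff]

theorem mem_powTorsion_singleton {x : X} :
    x ∈ powTorsion [f] X ↔ ∃ t : ℕ, f ^ t • x = 0 := by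
  simp [mem_powTorsion]

theorem powTorsion_cons : powTorsion (f :: l) X = powTorsion [f] X ⊓ powTorsion l X := by
  ext x
  simp [mem_powTorsion]

theorem pow_smul_mem_powTorsion_singleton_iff {m : ℕ} {x : X} :
    f ^ m • x ∈ powTorsion [f] X ↔ x ∈ powTorsion [f] X := by
  refine ⟨fun h => ?_, fun h => Submodule.smul_mem _ _ h⟩
  obtain ⟨t, ht⟩ := mem_powTorsion_singleton.1 h
  exact mem_powTorsion_singleton.2 ⟨t + m, by rw [pow_add, mul_smul, ht]⟩

theorem map_mem_powTorsion (g : X →ₗ[R] Y) {x : X} (hx : x ∈ powTorsion l X) :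
    g x ∈ powTorsion l Y := by
  rw [mem_powTorsion] at hx ⊢
  intro f hf
  obtain ⟨t, ht⟩ := hx f hf
  exact ⟨t, by rw [← map_smul, ht, map_zero]⟩

theorem map_mem_powTorsion_iff {g : X →ₗ[R] Y} (hg : Function.Injective g) {x : X} :
    g x ∈ powTorsion l Y ↔ x ∈ powTorsion l X := by
  simp only [mem_powTorsion, ← map_smul, map_eq_zero_iff g hg]

theorem mem_powTorsion_prod {x : X × Y} :
    x ∈ powTorsion l (X × Y) ↔ x.1 ∈ powTorsion l X ∧ x.2 ∈ powTorsion l Y := by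
  refine ⟨fun h => ⟨map_mem_powTorsion (LinearMap.fst R X Y) h,
    map_mem_powTorsion (LinearMap.snd R X Y) h⟩, fun h => ?_⟩
  simpa using add_mem (map_mem_powTorsion (LinearMap.inl R X Y) h.1)
    (map_mem_powTorsion (LinearMap.inr R X Y) h.2)

theorem mem_powTorsion_iff_exists_ofList_pow {x : X} :
    x ∈ powTorsion l X ↔ ∃ t : ℕ, ∀ r ∈ Ideal.ofList l ^ t, r • x = 0 := by
  refine ⟨fun hx => ?_, fun ⟨t, ht⟩ => mem_powTorsion.2 fun f hf =>
    ⟨t, ht _ (Ideal.pow_mem_pow (Ideal.subset_span (s := {g | g ∈ l}) hf) t)⟩⟩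
  induction l with
  | nil => exact ⟨1, fun r hr => by simp_all⟩
  | cons f l ih =>
    rw [powTorsion_cons] at hx
    obtain ⟨s, hs⟩ := mem_powTorsion_singleton.1 hx.1
    obtain ⟨t, ht⟩ := ih hx.2
    refine ⟨s + t, fun r hr => ?_⟩
    rw [Ideal.ofList_cons] at hr
    have hr' := Ideal.sup_pow_add_le_pow_sup_pow hr
    rw [Ideal.span_singleton_pow] at hr'
    obtain ⟨a, ha, b, hb, rfl⟩ := Submodule.mem_sup.1 hr'
    obtain ⟨c, rfl⟩ := Ideal.mem_span_singleton'.1 ha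
    rw [add_smul, mul_smul, hs, smul_zero, ht b hb, add_zero]

theorem mem_smul_sup_powTorsion_iff {U : Submodule R X} {x : X} :
    x ∈ f • U ⊔ powTorsion [f] X ↔ ∃ y ∈ U, x - f • y ∈ powTorsion [f] X := by
  rw [Submodule.mem_sup]
  constructor
  · rintro ⟨_, ⟨y, hy, rfl⟩, t, ht, rfl⟩
    exact ⟨y, hy, by simpa using ht⟩
  · rintro ⟨y, hy, h⟩
    exact ⟨f • y, Submodule.smul_mem_pointwise_smul y f U hy, _, h, add_sub_cancel _ _⟩

theorem map_mem_smul_sup_powTorsion {U : Submodule R X} {V : Submodule R Y} (g : X →ₗ[R] Y)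
    (hg : ∀ x ∈ U, g x ∈ V) {x : X} (hx : x ∈ f • U ⊔ powTorsion [f] X) :
    g x ∈ f • V ⊔ powTorsion [f] Y := by
  obtain ⟨y, hy, h⟩ := mem_smul_sup_powTorsion_iff.1 hx
  exact mem_smul_sup_powTorsion_iff.2
    ⟨g y, hg y hy, by simpa using map_mem_powTorsion g h⟩

theorem exists_sub_pow_smul_mem_powTorsion {U : Submodule R X}
    (hU : U ≤ f • U ⊔ powTorsion [f] X) (m : ℕ) {x : X} (hx : x ∈ U) :
    ∃ y ∈ U, x - f ^ m • y ∈ powTorsion [f] X := by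
  induction m with
  | zero => exact ⟨x, hx, by simp⟩
  | succ m ih =>
    obtain ⟨y, hy, hxy⟩ := ih
    obtain ⟨z, hz, hyz⟩ := mem_smul_sup_powTorsion_iff.1 (hU hy)
    refine ⟨z, hz, ?_⟩
    have h : x - f ^ (m + 1) • z = (x - f ^ m • y) + f ^ m • (y - f • z) := by
      rw [smul_sub, smul_smul, ← pow_succ, sub_add_sub_cancel]
    rw [h]
    exact add_mem hxy (Submodule.smul_mem _ _ hyz)

theorem exact_subtype_ker_rangeRestrict (g : X →ₗ[R] Y) :
    Function.Exact (LinearMap.ker g).subtype g.rangeRestrict := by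
  rw [LinearMap.exact_iff, Submodule.range_subtype, LinearMap.ker_rangeRestrict]

namespace IsTorsionAcyclic

theorem exists_powTorsion_lift (hX : IsTorsionAcyclic l X) {i : X →ₗ[R] Y} {p : Y →ₗ[R] Z}
    (hi : Function.Injective i) (hp : Function.Surjective p) (hip : Function.Exact i p) {z : Z}
    (hz : z ∈ powTorsion l Z) : ∃ y ∈ powTorsion l Y, p y = z := by
  induction l generalizing z with
  | nil =>
    obtain ⟨y, rfl⟩ := hp z
    exact ⟨y, by simp [mem_powTorsion], rfl⟩
  | cons f l ih =>
    rw [powTorsion_cons] at hz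
    obtain ⟨m, hm⟩ := mem_powTorsion_singleton.1 hz.1
    obtain ⟨y, hy, rfl⟩ := ih hX.1 hz.2
    obtain ⟨x, hx⟩ := (hip (f ^ m • y)).1 (by rw [map_smul, hm])
    have hxl : x ∈ powTorsion l X :=
      (map_mem_powTorsion_iff hi).1 (hx ▸ Submodule.smul_mem _ _ hy)
    obtain ⟨x', hx', hxx'⟩ := exists_sub_pow_smul_mem_powTorsion hX.2 m hxl
    refine ⟨y - i x', ?_, by rw [map_sub, hip.apply_apply_eq_zero, sub_zero]⟩
    rw [powTorsion_cons]
    refine ⟨(pow_smul_mem_powTorsion_singleton_iff (m := m)).1 ?_,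
      sub_mem hy (map_mem_powTorsion i hx')⟩
    simpa [smul_sub, hx] using map_mem_powTorsion i hxx'

theorem of_exact (hX : IsTorsionAcyclic l X) (hY : IsTorsionAcyclic l Y) {i : X →ₗ[R] Y}
    {p : Y →ₗ[R] Z} (hi : Function.Injective i) (hp : Function.Surjective p)
    (hip : Function.Exact i p) : IsTorsionAcyclic l Z := by
  induction l with
  | nil => trivial
  | cons f l ih =>
    refine ⟨ih hX.1 hY.1, fun z hz => ?_⟩
    obtain ⟨y, hy, rfl⟩ := hX.1.exists_powTorsion_lift hi hp hip hz
    exact map_mem_smul_sup_powTorsion p (fun _ => map_mem_powTorsion p) (hY.2 hy)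

theorem of_leftInverse (hY : IsTorsionAcyclic l Y) {i : X →ₗ[R] Y} {p : Y →ₗ[R] X}
    (hpi : Function.LeftInverse p i) : IsTorsionAcyclic l X := by
  induction l with
  | nil => trivial
  | cons f l ih =>
    refine ⟨ih hY.1, fun x hx => ?_⟩
    rw [← hpi x]
    exact map_mem_smul_sup_powTorsion p (fun _ => map_mem_powTorsion p)
      (hY.2 (map_mem_powTorsion i hx))

theorem of_linearEquiv (hX : IsTorsionAcyclic l X) (e : X ≃ₗ[R] Y) : IsTorsionAcyclic l Y :=
  hX.of_leftInverse (i := e.symm.toLinearMap) (p := e.toLinearMap) e.apply_symm_apply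

theorem prod (hX : IsTorsionAcyclic l X) (hY : IsTorsionAcyclic l Y) :
    IsTorsionAcyclic l (X × Y) := by
  induction l with
  | nil => trivial
  | cons f l ih =>
    refine ⟨ih hX.1 hY.1, fun x hx => ?_⟩
    obtain ⟨hx₁, hx₂⟩ := mem_powTorsion_prod.1 hx
    simpa using add_mem
      (map_mem_smul_sup_powTorsion (LinearMap.inl R X Y) (fun _ => map_mem_powTorsion _) (hX.2 hx₁))
      (map_mem_smul_sup_powTorsion (LinearMap.inr R X Y) (fun _ => map_mem_powTorsion _) (hY.2 hx₂))

theorem ker_of_exact {K : ℕ → Type*} [∀ j, AddCommGroup (K j)] [∀ j, Module R (K j)]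
    {d : ∀ j, K j →ₗ[R] K (j + 1)} (hK : ∀ j, IsTorsionAcyclic l (K j))
    (h₀ : IsTorsionAcyclic l (LinearMap.ker (d 0)))
    (hd : ∀ j, Function.Exact (d j) (d (j + 1))) (j : ℕ) :
    IsTorsionAcyclic l (LinearMap.ker (d j)) := by
  induction j with
  | zero => exact h₀
  | succ j ih =>
    rw [(hd j).linearMap_ker_eq]
    exact ih.of_exact (hK j) (Submodule.injective_subtype _) (d j).surjective_rangeRestrict
      (exact_subtype_ker_rangeRestrict (d j))

theorem exists_powTorsion_preimage {K : ℕ → Type*} [∀ j, AddCommGroup (K j)]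
    [∀ j, Module R (K j)] {γ : X →ₗ[R] K 0} {d : ∀ j, K j →ₗ[R] K (j + 1)}
    (hX : IsTorsionAcyclic l X) (hK : ∀ j, IsTorsionAcyclic l (K j))
    (hγ : Function.Injective γ) (hγd : Function.Exact γ (d 0))
    (hd : ∀ j, Function.Exact (d j) (d (j + 1))) (j : ℕ) {x : K (j + 1)}
    (hx : x ∈ powTorsion l (K (j + 1))) (hdx : d (j + 1) x = 0) :
    ∃ y ∈ powTorsion l (K j), d j y = x := by
  have h₀ : IsTorsionAcyclic l (LinearMap.ker (d 0)) := by
    rw [hγd.linearMap_ker_eq]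
    exact hX.of_linearEquiv (LinearEquiv.ofInjective γ hγ)
  obtain ⟨x', rfl⟩ := (hd j x).1 hdx
  obtain ⟨y, hy, hyx⟩ := (ker_of_exact hK h₀ hd j).exists_powTorsion_lift
    (Submodule.injective_subtype _) (d j).surjective_rangeRestrict
    (exact_subtype_ker_rangeRestrict (d j)) (z := (d j).rangeRestrict x')
    ((map_mem_powTorsion_iff (Submodule.injective_subtype _)).1 hx)
  exact ⟨y, hy, congrArg Subtype.val hyx⟩

end IsTorsionAcyclic

end Torsion

section Injective

theorem exists_pow_mul_eq_zero_of_pow_succ_mul_eq_zero {R : Type*} [CommRing R]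
    [IsNoetherianRing R] (f : R) : ∃ m : ℕ, ∀ r, f ^ (m + 1) * r = 0 → f ^ m * r = 0 := by
  obtain ⟨m, hm⟩ := (LinearMap.eventually_iSup_ker_pow_eq (LinearMap.mulLeft R f)).exists
  refine ⟨m, fun r hr => ?_⟩
  have h : r ∈ LinearMap.ker (LinearMap.mulLeft R f ^ m) :=
    hm ▸ Submodule.mem_iSup_of_mem (m + 1) (by simpa [LinearMap.pow_mulLeft] using hr)
  simpa [LinearMap.pow_mulLeft] using h

theorem exists_mul_eq_mul_of_mul_mem_pow_add {R : Type*} [CommRing R] [IsNoetherianRing R]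
    (a : Ideal R) (g : R) :
    ∃ c : ℕ, ∀ t r, g * r ∈ a ^ (t + c) → ∃ b ∈ a ^ t, g * r = g * b := by
  obtain ⟨c, hc⟩ := Ideal.exists_pow_inf_eq_pow_smul (M := R) a (Ideal.span {g})
  refine ⟨c, fun t r hr => ?_⟩
  have h : g * r ∈ (a ^ (t + c) • ⊤ : Ideal R) ⊓ Ideal.span {g} :=
    ⟨by simpa using hr, Ideal.mem_span_singleton.2 (dvd_mul_right _ _)⟩
  rw [hc (t + c) (Nat.le_add_left c t), Nat.add_sub_cancel] at h
  obtain ⟨b, hb, hbr⟩ := Ideal.mem_mul_span_singleton.1 (Ideal.mul_mono_right inf_le_right h)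
  exact ⟨b, hb, by rw [← hbr, mul_comm]⟩

theorem exists_comp_eq_of_ker_le_ker {R N : Type u} {X Y : Type*} [Ring R] [AddCommGroup X]
    [Module R X] [AddCommGroup Y] [Module R Y] [AddCommGroup N] [Module R N]
    [Module.Injective R N] (μ : X →ₗ[R] Y) (ν : X →ₗ[R] N)
    (h : LinearMap.ker μ ≤ LinearMap.ker ν) : ∃ ψ : Y →ₗ[R] N, ψ ∘ₗ μ = ν := by
  obtain ⟨ψ, hψ⟩ := Module.Injective.extension_property R N _ _ ((LinearMap.ker μ).liftQ μ le_rfl)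
    (LinearMap.ker_eq_bot.1 (Submodule.ker_liftQ_eq_bot' _ _ rfl)) ((LinearMap.ker μ).liftQ ν h)
  refine ⟨ψ, ?_⟩
  rw [← (LinearMap.ker μ).liftQ_mkQ ν h, ← hψ, LinearMap.comp_assoc, Submodule.liftQ_mkQ]

theorem IsTorsionAcyclic.of_injective {R N : Type u} [CommRing R] [IsNoetherianRing R]
    [AddCommGroup N] [Module R N] [Module.Injective R N] (l : List R) :
    IsTorsionAcyclic l N := by
  induction l with
  | nil => trivial
  | cons f l ih =>
    refine ⟨ih, fun x hx => mem_smul_sup_powTorsion_iff.2 ?_⟩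
    obtain ⟨t, ht⟩ := mem_powTorsion_iff_exists_ofList_pow.1 hx
    obtain ⟨m, hm⟩ := exists_pow_mul_eq_zero_of_pow_succ_mul_eq_zero f
    obtain ⟨c, hc⟩ := exists_mul_eq_mul_of_mul_mem_pow_add (Ideal.ofList l) (f ^ (m + 1))
    let a := Ideal.ofList l ^ (t + c)
    have hker : LinearMap.ker (a.mkQ ∘ₗ LinearMap.mulLeft R (f ^ (m + 1))) ≤
        LinearMap.ker (LinearMap.toSpanSingleton R N (f ^ m • x)) := fun r hr => by
      obtain ⟨b, hb, hbr⟩ := hc t r ((Submodule.Quotient.mk_eq_zero a).1 hr)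
      have hrb : f ^ m * (r - b) = 0 := hm _ (by rw [mul_sub, hbr, sub_self])
      rw [mul_sub, sub_eq_zero] at hrb
      rw [LinearMap.mem_ker, LinearMap.toSpanSingleton_apply, smul_smul, mul_comm, hrb, mul_smul,
        ht b hb, smul_zero]
    obtain ⟨ψ, hψ⟩ := exists_comp_eq_of_ker_le_ker _ _ hker
    refine ⟨ψ (a.mkQ 1), mem_powTorsion_iff_exists_ofList_pow.2 ⟨t + c, fun r hr => ?_⟩,
      mem_powTorsion_singleton.2 ⟨m, ?_⟩⟩
    · rw [← map_smul, ← map_smul, smul_eq_mul, mul_one, a.mkQ_apply,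
        (Submodule.Quotient.mk_eq_zero _).2 hr, map_zero]
    · have h : ψ (a.mkQ (f ^ (m + 1) • 1)) = f ^ m • x := by
        simpa using LinearMap.congr_fun hψ 1
      rw [smul_sub, smul_smul, ← pow_succ, ← map_smul, ← map_smul, h, sub_self]

end Injective

namespace ZGradedModule

section Graded

open scoped Pointwise

variable {k R : Type u} [CommRing k] [CommRing R] [Algebra k R] {𝒜 : ℕ → Submodule k R}

theorem mem_of_proj_mem (X : ZGradedModule 𝒜) {U : Submodule k X} {x : X}
    (h : ∀ n, X.proj n x ∈ U) : x ∈ U := by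
  classical
  have hx : DirectSum.coeLinearMap X.deg (X.decomp x) = x :=
    (LinearEquiv.ofBijective (DirectSum.coeLinearMap X.deg) X.isInternal).apply_symm_apply x
  rw [← hx, DirectSum.coeLinearMap_eq_dfinsuppSum]
  exact Submodule.sum_mem _ fun n _ => h n

theorem proj_smul (X : ZGradedModule 𝒜) {a : ℕ} {r : R} (hr : r ∈ 𝒜 a) (n : ℤ) (x : X) :
    X.proj (a + n) (r • x) = r • X.proj n x := by
  refine X.hom_ext (X.proj (a + n) ∘ₗ Module.toModuleEnd k (S := R) X r)
    (Module.toModuleEnd k (S := R) X r ∘ₗ X.proj n) (fun m y hy => ?_) x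
  change X.proj (a + n) (r • y) = r • X.proj n y
  by_cases hnm : n = m
  · subst hnm
    rw [X.proj_self n y hy, X.proj_self _ _ (X.smul_mem hr hy)]
  · rw [X.proj_ne n m hnm y hy, X.proj_ne _ _ (by simpa using hnm) _ (X.smul_mem hr hy), smul_zero]

theorem mem_torsionDeg_ofList {X : ZGradedModule 𝒜} {l : List R} {n : ℤ} {x : X} :
    x ∈ torsionDeg (Ideal.ofList l) X n ↔ x ∈ X.deg n ∧ x ∈ powTorsion l X := by
  rw [mem_powTorsion_iff_exists_ofList_pow]
  rfl

theorem IsGradedInjective.exists_extension {I : ZGradedModule 𝒜} (hI : I.IsGradedInjective)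
    {Y Z : ZGradedModule 𝒜} {b : Y →ₗ[R] Z} (hb : IsGradedMap b) {ψ : Y →ₗ[R] I}
    (hψ : IsGradedMap ψ) (h : LinearMap.ker b ≤ LinearMap.ker ψ) :
    ∃ χ : Z →ₗ[R] I, IsGradedMap χ ∧ ∀ y, χ (b y) = ψ y := by
  let Q : ZGradedModule 𝒜 := Y.ofSurjective (Y ⧸ LinearMap.ker b) (LinearMap.ker b).mkQ
    (Submodule.mkQ_surjective _) (by
      intro y hy n
      rw [Submodule.mkQ_apply, Submodule.Quotient.mk_eq_zero, LinearMap.mem_ker] at hy ⊢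
      rw [← proj_map b hb, hy, map_zero])
  obtain ⟨χ, hχ, he⟩ := hI Q Z ((LinearMap.ker b).liftQ b le_rfl) ((LinearMap.ker b).liftQ ψ h)
    (by rintro n _ ⟨y, hy, rfl⟩; exact hb n y hy)
    (LinearMap.ker_eq_bot.1 (Submodule.ker_liftQ_eq_bot' _ _ rfl))
    (by rintro n _ ⟨y, hy, rfl⟩; exact hψ n y hy)
  exact ⟨χ, hχ, fun y => LinearMap.congr_fun he (Submodule.Quotient.mk y)⟩

variable [GradedAlgebra 𝒜] {l : List R}

theorem proj_mem_powTorsion (X : ZGradedModule 𝒜) (hl : ∀ f ∈ l, SetLike.IsHomogeneousElem 𝒜 f)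
    {x : X} (hx : x ∈ powTorsion l X) (n : ℤ) : X.proj n x ∈ powTorsion l X := by
  rw [mem_powTorsion] at hx ⊢
  intro f hf
  obtain ⟨a, ha⟩ := hl f hf
  obtain ⟨t, ht⟩ := hx f hf
  exact ⟨t, by rw [← X.proj_smul (SetLike.pow_mem_graded t ha), ht, map_zero]⟩

section Coinduced

variable (N : Type u) [AddCommGroup N] [Module k N] [Module R N] [IsScalarTower k R N]

/-- The monomial `x T ^ n`, as an element of the graded module `N[T, T⁻¹]`. -/
noncomputable def coinducedMono (n : ℤ) : N →ₗ[k] coinduced 𝒜 N := Laurent.mono 𝒜 N n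

variable {N}

theorem coinducedMono_injective (n : ℤ) : Function.Injective (coinducedMono (𝒜 := 𝒜) N n) :=
  Function.LeftInverse.injective (Laurent.coeff_mono_self 𝒜 N n)

theorem smul_coinducedMono {a : ℕ} {r : R} (hr : r ∈ 𝒜 a) (n : ℤ) (x : N) :
    r • coinducedMono (𝒜 := 𝒜) N n x = coinducedMono N (a + n) (r • x) :=
  Laurent.smul_mono 𝒜 N hr n x

theorem coinducedMono_mem_powTorsion_iff (hl : ∀ f ∈ l, SetLike.IsHomogeneousElem 𝒜 f) {n : ℤ}
    {x : N} : coinducedMono N n x ∈ powTorsion l (coinduced 𝒜 N) ↔ x ∈ powTorsion l N := by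
  simp only [mem_powTorsion]
  refine forall₂_congr fun f hf => exists_congr fun t => ?_
  obtain ⟨a, ha⟩ := hl f hf
  rw [smul_coinducedMono (SetLike.pow_mem_graded t ha),
    map_eq_zero_iff _ (coinducedMono_injective _)]

theorem isTorsionAcyclic_coinduced (hl : ∀ f ∈ l, SetLike.IsHomogeneousElem 𝒜 f)
    (hN : IsTorsionAcyclic l N) : IsTorsionAcyclic l (coinduced 𝒜 N) := by
  induction l with
  | nil => trivial
  | cons f l ih =>
    rw [List.forall_mem_cons] at hl
    obtain ⟨⟨a, ha⟩, hl'⟩ := hl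
    refine ⟨ih hl' hN.1, fun x hx => ?_⟩
    let U := powTorsion l (coinduced 𝒜 N)
    refine (coinduced 𝒜 N).mem_of_proj_mem (U := (f • U ⊔ powTorsion [f] _).restrictScalars k)
      fun n => mem_smul_sup_powTorsion_iff.2 ?_
    obtain ⟨v, hv⟩ : ∃ v, coinducedMono N n v = (coinduced 𝒜 N).proj n x :=
      (coinduced 𝒜 N).proj_mem n x
    have hvl : v ∈ powTorsion l N := (coinducedMono_mem_powTorsion_iff hl').1
      (hv ▸ (coinduced 𝒜 N).proj_mem_powTorsion hl' hx n)
    obtain ⟨w, hw, hvw⟩ := mem_smul_sup_powTorsion_iff.1 (hN.2 hvl)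
    refine ⟨coinducedMono N (n - a) w, (coinducedMono_mem_powTorsion_iff hl').2 hw, ?_⟩
    rw [← hv, smul_coinducedMono ha, add_sub_cancel, ← map_sub]
    exact (coinducedMono_mem_powTorsion_iff (by simpa using ⟨a, ha⟩)).2 hvw

end Coinduced

theorem IsGradedInjective.isTorsionAcyclic [IsNoetherianRing R] {E : ZGradedModule 𝒜}
    (hE : E.IsGradedInjective) (hl : ∀ f ∈ l, SetLike.IsHomogeneousElem 𝒜 f) :
    IsTorsionAcyclic l E := by
  obtain ⟨⟨I, hI, f, hf⟩⟩ := CategoryTheory.EnoughInjectives.presentation (ModuleCat.of R E)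
  have : Module.Injective R I := Module.injective_module_of_injective_object R I
  let _ : Module k I := Module.compHom I (algebraMap k R)
  have : IsScalarTower k R I := .of_algebraMap_smul fun _ _ => rfl
  obtain ⟨p, -, hp⟩ := hE E (coinduced 𝒜 I) (lift f.hom) LinearMap.id (lift_graded _)
    (lift_injective _ ((ModuleCat.mono_iff_injective f).1 hf)) (fun _ _ h => h)
  exact (isTorsionAcyclic_coinduced hl (.of_injective (N := I) l)).of_leftInverse
    (LinearMap.congr_fun hp)

end Graded

end ZGradedModule

section Cone

variable {R : Type*} [CommRing R] {C D : ℕ → Type*} [∀ i, AddCommGroup (C i)]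
  [∀ i, Module R (C i)] [∀ i, AddCommGroup (D i)] [∀ i, Module R (D i)]

/-- The differential of the mapping cone of a chain map `φ : C → D`, whose term of degree `i` is
`C (i + 1) × D i`. -/
def coneDiff (dC : ∀ i, C i →ₗ[R] C (i + 1)) (dD : ∀ i, D i →ₗ[R] D (i + 1))
    (φ : ∀ i, C i →ₗ[R] D i) (i : ℕ) : C (i + 1) × D i →ₗ[R] C (i + 1 + 1) × D (i + 1) :=
  (dC (i + 1) ∘ₗ LinearMap.fst R _ _).prod
    (φ (i + 1) ∘ₗ LinearMap.fst R _ _ - dD i ∘ₗ LinearMap.snd R _ _)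

variable {dC : ∀ i, C i →ₗ[R] C (i + 1)} {dD : ∀ i, D i →ₗ[R] D (i + 1)} {φ : ∀ i, C i →ₗ[R] D i}

theorem coneDiff_eq_zero_iff {i : ℕ} {x : C (i + 1)} {e : D i} :
    coneDiff dC dD φ i (x, e) = 0 ↔ dC (i + 1) x = 0 ∧ φ (i + 1) x = dD i e := by
  simp [coneDiff, sub_eq_zero]

theorem exact_coneDiff_succ (hφ : ∀ i c, φ (i + 1) (dC i c) = dD i (φ i c))
    (hC : ∀ i, Function.Exact (dC i) (dC (i + 1))) (hD : ∀ i, Function.Exact (dD i) (dD (i + 1)))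
    (i : ℕ) : Function.Exact (coneDiff dC dD φ i) (coneDiff dC dD φ (i + 1)) := by
  rintro ⟨x, e⟩
  rw [coneDiff_eq_zero_iff]
  constructor
  · rintro ⟨hx, hxe⟩
    obtain ⟨c, rfl⟩ := (hC (i + 1) x).1 hx
    obtain ⟨e', he'⟩ := (hD i (φ (i + 1) c - e)).1 (by rw [map_sub, ← hφ, hxe, sub_self])
    exact ⟨(c, e'), by simp [coneDiff, he']⟩
  · rintro ⟨⟨c, e'⟩, hc⟩
    obtain ⟨rfl, rfl⟩ := Prod.ext_iff.1 hc
    simp [coneDiff, hφ, (hC (i + 1)).apply_apply_eq_zero, (hD i).apply_apply_eq_zero]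

variable {M : Type*} [AddCommGroup M] [Module R M] {α : M →ₗ[R] C 0} {β : M →ₗ[R] D 0}

theorem injective_prod_of_exact (hβ : Function.Injective β) (hφ₀ : ∀ m, φ 0 (α m) = β m)
    (hα : Function.Exact α (dC 0)) : Function.Injective ((dC 0).prod (φ 0)) := by
  rw [← LinearMap.ker_eq_bot, LinearMap.ker_eq_bot']
  intro c hc
  obtain ⟨h₁, h₂⟩ := Prod.ext_iff.1 hc
  obtain ⟨m, rfl⟩ := (hα c).1 h₁
  rw [(injective_iff_map_eq_zero β).1 hβ m ((hφ₀ m).symm.trans h₂), map_zero]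

theorem exact_prod_coneDiff_zero (hφ₀ : ∀ m, φ 0 (α m) = β m)
    (hφ : ∀ i c, φ (i + 1) (dC i c) = dD i (φ i c)) (hα : Function.Exact α (dC 0))
    (hβ : Function.Exact β (dD 0)) (hC : Function.Exact (dC 0) (dC 1)) :
    Function.Exact ((dC 0).prod (φ 0)) (coneDiff dC dD φ 0) := by
  rintro ⟨x, e⟩
  rw [coneDiff_eq_zero_iff]
  constructor
  · rintro ⟨hx, hxe⟩
    obtain ⟨c, rfl⟩ := (hC x).1 hx
    obtain ⟨m, hm⟩ := (hβ (φ 0 c - e)).1 (by rw [map_sub, ← hφ, hxe, sub_self])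
    exact ⟨c - α m, by simp [hα.apply_apply_eq_zero, hφ₀, hm]⟩
  · rintro ⟨c, hc⟩
    obtain ⟨rfl, rfl⟩ := Prod.ext_iff.1 hc
    simp [hφ, hC.apply_apply_eq_zero]

end Cone

theorem nonempty_subquotient_equiv {k V W : Type*} [CommRing k] [AddCommGroup V] [Module k V]
    [AddCommGroup W] [Module k W] (g : V →ₗ[k] W) {Z B : Submodule k V} {Z' B' : Submodule k W}
    (hZ : ∀ z ∈ Z, g z ∈ Z') (hB : ∀ b ∈ B, g b ∈ B')
    (hsurj : ∀ z' ∈ Z', ∃ z ∈ Z, g z - z' ∈ B') (hinj : ∀ z ∈ Z, g z ∈ B' → z ∈ B) :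
    Nonempty ((Z ⧸ B.submoduleOf Z) ≃ₗ[k] (Z' ⧸ B'.submoduleOf Z')) := by
  have hle : B.submoduleOf Z ≤ (B'.submoduleOf Z').comap (g.restrict hZ) := fun z hz => hB z hz
  refine ⟨LinearEquiv.ofBijective (Submodule.mapQ _ _ (g.restrict hZ) hle) ⟨?_, ?_⟩⟩
  · rw [← LinearMap.ker_eq_bot, LinearMap.ker_eq_bot']
    intro x hx
    obtain ⟨z, rfl⟩ := Submodule.Quotient.mk_surjective _ x
    rw [Submodule.mapQ_apply, Submodule.Quotient.mk_eq_zero] at hx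
    exact (Submodule.Quotient.mk_eq_zero _).2 (hinj z z.2 hx)
  · intro y
    obtain ⟨z', rfl⟩ := Submodule.Quotient.mk_surjective _ y
    obtain ⟨z, hz, hzz⟩ := hsurj z' z'.2
    refine ⟨Submodule.Quotient.mk ⟨z, hz⟩, ?_⟩
    rw [Submodule.mapQ_apply, Submodule.Quotient.eq]
    exact hzz

namespace ZGradedModule

variable {k R : Type u} [CommRing k] [CommRing R] [Algebra k R] {𝒜 : ℕ → Submodule k R}

/-- A resolution `0 → M → C⁰ → C¹ → ⋯` in the category of graded `R`-modules. -/
structure Resolution (M : ZGradedModule 𝒜) where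
  obj : ℕ → ZGradedModule 𝒜
  ι : M →ₗ[R] obj 0
  ι_graded : IsGradedMap ι
  ι_injective : Function.Injective ι
  d : ∀ i, obj i →ₗ[R] obj (i + 1)
  d_graded : ∀ i, IsGradedMap (d i)
  exact_zero : Function.Exact ι (d 0)
  exact_succ : ∀ i, Function.Exact (d i) (d (i + 1))

namespace Resolution

variable {M : ZGradedModule 𝒜} (C D : Resolution M) (J : Ideal R)

/-- The cocycles of the complex `Γ_J(C)ₙ` of `k`-modules. -/
def cocycles (i : ℕ) (n : ℤ) : Submodule k (C.obj i) :=
  torsionDeg J (C.obj i) n ⊓ LinearMap.ker ((C.d i).restrictScalars k)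

/-- The coboundaries of the complex `Γ_J(C)ₙ` of `k`-modules. -/
def coboundaries : (i : ℕ) → (n : ℤ) → Submodule k (C.obj i)
  | 0, _ => ⊥
  | i + 1, n => (torsionDeg J (C.obj i) n).map ((C.d i).restrictScalars k)

/-- The `i`-th cohomology of the complex `Γ_J(C)ₙ` of `k`-modules. -/
abbrev cohomology (i : ℕ) (n : ℤ) : Type u :=
  C.cocycles J i n ⧸ (C.coboundaries J i n).submoduleOf (C.cocycles J i n)

/-- A graded chain map between resolutions of `M` over the identity of `M`. -/
structure Hom where
  app : ∀ i, C.obj i →ₗ[R] D.obj i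
  app_graded : ∀ i, IsGradedMap (app i)
  comm_ι : ∀ m, app 0 (C.ι m) = D.ι m
  comm_d : ∀ i c, app (i + 1) (C.d i c) = D.d i (app i c)

variable {C D J} {n : ℤ}

theorem nonempty_hom (hD : ∀ i, (D.obj i).IsGradedInjective) : Nonempty (Hom C D) := by
  obtain ⟨φ₀, hφ₀, h₀⟩ := (hD 0).exists_extension C.ι_graded D.ι_graded (by
    rw [LinearMap.ker_eq_bot.2 C.ι_injective]; exact bot_le)
  let P : ℕ → Type u := fun i => {φ : C.obj i →ₗ[R] D.obj i //
    IsGradedMap φ ∧ LinearMap.ker (C.d i) ≤ LinearMap.ker (D.d i ∘ₗ φ)}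
  have extend : ∀ i (φ : P i), ∃ φ' : P (i + 1), ∀ c, φ'.1 (C.d i c) = D.d i (φ.1 c) := by
    rintro i ⟨φ, hφ, hker⟩
    obtain ⟨χ, hχ, he⟩ := (hD (i + 1)).exists_extension (C.d_graded i)
      (fun n x hx => D.d_graded i n _ (hφ n x hx)) hker
    refine ⟨⟨χ, hχ, fun c hc => ?_⟩, he⟩
    obtain ⟨c, rfl⟩ := (C.exact_succ i c).1 hc
    rw [LinearMap.mem_ker, LinearMap.comp_apply, he]
    exact (D.exact_succ i).apply_apply_eq_zero _
  choose s hs using extend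
  let φ : ∀ i, P i := fun i => Nat.rec ⟨φ₀, hφ₀, fun c hc => by
    obtain ⟨m, rfl⟩ := (C.exact_zero c).1 hc
    rw [LinearMap.mem_ker, LinearMap.comp_apply, h₀]
    exact D.exact_zero.apply_apply_eq_zero m⟩ s i
  exact ⟨⟨fun i => (φ i).1, fun i => (φ i).2.1, h₀, fun i => hs i (φ i)⟩⟩

namespace Hom

theorem app_mem_torsionDeg (φ : Hom C D) {i : ℕ} {x : C.obj i}
    (hx : x ∈ torsionDeg J (C.obj i) n) : φ.app i x ∈ torsionDeg J (D.obj i) n := by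
  obtain ⟨hxn, t, ht⟩ := hx
  exact ⟨φ.app_graded i n x hxn, t, fun r hr => by rw [← map_smul, ht r hr, map_zero]⟩

theorem app_mem_cocycles (φ : Hom C D) {i : ℕ} {x : C.obj i} (hx : x ∈ C.cocycles J i n) :
    φ.app i x ∈ D.cocycles J i n :=
  ⟨φ.app_mem_torsionDeg hx.1, ((φ.comm_d i x).symm.trans
    (congrArg (φ.app (i + 1)) hx.2)).trans (map_zero _)⟩

theorem app_mem_coboundaries (φ : Hom C D) {i : ℕ} {x : C.obj i}
    (hx : x ∈ C.coboundaries J i n) : φ.app i x ∈ D.coboundaries J i n := by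
  cases i with
  | zero =>
    obtain rfl : x = 0 := hx
    rw [map_zero]
    exact zero_mem _
  | succ i =>
    obtain ⟨c, hc, rfl⟩ := hx
    exact ⟨φ.app i c, φ.app_mem_torsionDeg hc, (φ.comm_d i c).symm⟩

theorem eq_zero_of_app_eq_zero (φ : Hom C D) {x : C.obj 0} (hdx : C.d 0 x = 0)
    (hx : φ.app 0 x = 0) : x = 0 := by
  have h := injective_prod_of_exact (φ := φ.app) D.ι_injective φ.comm_ι C.exact_zero
  exact (injective_iff_map_eq_zero _).1 h x (Prod.ext hdx hx)

theorem exact_coneDiff_zero (φ : Hom C D) :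
    Function.Exact ((C.d 0).prod (φ.app 0)) (coneDiff C.d D.d φ.app 0) :=
  exact_prod_coneDiff_zero φ.comm_ι φ.comm_d C.exact_zero D.exact_zero (C.exact_succ 0)

section Acyclic

variable {l : List R}

theorem exists_powTorsion_preimage_zero (φ : Hom C D) {x : C.obj 1} {e : D.obj 0}
    (hx : x ∈ powTorsion l (C.obj 1)) (he : e ∈ powTorsion l (D.obj 0)) (hdx : C.d 1 x = 0)
    (hxe : φ.app 1 x = D.d 0 e) :
    ∃ y ∈ powTorsion l (C.obj 0), C.d 0 y = x ∧ φ.app 0 y = e := by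
  obtain ⟨y, hy⟩ := (φ.exact_coneDiff_zero (x, e)).1 (coneDiff_eq_zero_iff.2 ⟨hdx, hxe⟩)
  have hinj := injective_prod_of_exact (φ := φ.app) D.ι_injective φ.comm_ι C.exact_zero
  exact ⟨y, (map_mem_powTorsion_iff hinj).1 (hy ▸ mem_powTorsion_prod.2 ⟨hx, he⟩),
    Prod.ext_iff.1 hy⟩

theorem exists_powTorsion_preimage_succ (φ : Hom C D) (hC : ∀ i, IsTorsionAcyclic l (C.obj i))
    (hD : ∀ i, IsTorsionAcyclic l (D.obj i)) {i : ℕ} {x : C.obj (i + 2)} {e : D.obj (i + 1)}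
    (hx : x ∈ powTorsion l (C.obj (i + 2))) (he : e ∈ powTorsion l (D.obj (i + 1)))
    (hdx : C.d (i + 2) x = 0) (hxe : φ.app (i + 2) x = D.d (i + 1) e) :
    ∃ y ∈ powTorsion l (C.obj (i + 1)), ∃ e' ∈ powTorsion l (D.obj i),
      C.d (i + 1) y = x ∧ φ.app (i + 1) y - D.d i e' = e := by
  obtain ⟨⟨y, e'⟩, hye, h⟩ := (hC 0).exists_powTorsion_preimage
    (fun i => (hC (i + 1)).prod (hD i))
    (injective_prod_of_exact (φ := φ.app) D.ι_injective φ.comm_ι C.exact_zero)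
    φ.exact_coneDiff_zero (exact_coneDiff_succ φ.comm_d C.exact_succ D.exact_succ) i
    (mem_powTorsion_prod.2 ⟨hx, he⟩) (coneDiff_eq_zero_iff.2 ⟨hdx, hxe⟩)
  obtain ⟨hy, he'⟩ := mem_powTorsion_prod.1 hye
  exact ⟨y, hy, e', he', Prod.ext_iff.1 h⟩

variable [GradedAlgebra 𝒜]

theorem exists_torsionDeg_preimage (φ : Hom C D) (hl : ∀ f ∈ l, SetLike.IsHomogeneousElem 𝒜 f)
    (hC : ∀ i, IsTorsionAcyclic l (C.obj i)) (hD : ∀ i, IsTorsionAcyclic l (D.obj i)) {i : ℕ}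
    {x : C.obj (i + 1)} {e : D.obj i} (hx : x ∈ torsionDeg (Ideal.ofList l) (C.obj (i + 1)) n)
    (he : e ∈ torsionDeg (Ideal.ofList l) (D.obj i) n) (hdx : C.d (i + 1) x = 0)
    (hxe : φ.app (i + 1) x = D.d i e) :
    ∃ y ∈ torsionDeg (Ideal.ofList l) (C.obj i) n,
      C.d i y = x ∧ φ.app i y - e ∈ D.coboundaries (Ideal.ofList l) i n := by
  have proj_mem {X : ZGradedModule 𝒜} {x : X} (hx : x ∈ powTorsion l X) :
      X.proj n x ∈ torsionDeg (Ideal.ofList l) X n :=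
    mem_torsionDeg_ofList.2 ⟨X.proj_mem n x, X.proj_mem_powTorsion hl hx n⟩
  rw [mem_torsionDeg_ofList] at hx he
  cases i with
  | zero =>
    obtain ⟨y, hy, rfl, rfl⟩ := φ.exists_powTorsion_preimage_zero hx.2 he.2 hdx hxe
    refine ⟨_, proj_mem hy, ?_, ?_⟩
    · rw [← proj_map _ (C.d_graded 0), proj_self _ _ _ hx.1]
    · rw [← proj_map _ (φ.app_graded 0), proj_self _ _ _ he.1, sub_self]
      exact zero_mem _
  | succ i =>
    obtain ⟨y, hy, e', he', rfl, rfl⟩ :=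
      φ.exists_powTorsion_preimage_succ hC hD hx.2 he.2 hdx hxe
    refine ⟨_, proj_mem hy, ?_, _, proj_mem he', ?_⟩
    · rw [← proj_map _ (C.d_graded _), proj_self _ _ _ hx.1]
    · rw [LinearMap.restrictScalars_apply, ← proj_map _ (φ.app_graded _),
        ← proj_map _ (D.d_graded _), ← proj_self _ _ _ he.1, map_sub, sub_sub_cancel]

theorem nonempty_cohomology_equiv (φ : Hom C D) (hl : ∀ f ∈ l, SetLike.IsHomogeneousElem 𝒜 f)
    (hC : ∀ i, IsTorsionAcyclic l (C.obj i)) (hD : ∀ i, IsTorsionAcyclic l (D.obj i)) (i : ℕ)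
    (n : ℤ) :
    Nonempty (C.cohomology (Ideal.ofList l) i n ≃ₗ[k] D.cohomology (Ideal.ofList l) i n) := by
  refine nonempty_subquotient_equiv ((φ.app i).restrictScalars k)
    (fun _ => φ.app_mem_cocycles) (fun _ => φ.app_mem_coboundaries) ?_ ?_
  · rintro e ⟨he, hde⟩
    obtain ⟨y, hy, hdy, hye⟩ := φ.exists_torsionDeg_preimage hl hC hD (x := 0) (zero_mem _) he
      (map_zero _) ((map_zero _).trans (Eq.symm hde))
    exact ⟨y, ⟨hy, hdy⟩, hye⟩
  · rintro z ⟨hz, hdz⟩ hb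
    cases i with
    | zero => exact φ.eq_zero_of_app_eq_zero hdz hb
    | succ i =>
      obtain ⟨e, he, hez⟩ := hb
      obtain ⟨y, hy, hdy, -⟩ := φ.exists_torsionDeg_preimage hl hC hD hz he hdz hez.symm
      exact ⟨y, hy, hdy⟩

end Acyclic

end Hom

end Resolution

namespace InjectiveResolution

variable {M : ZGradedModule 𝒜}

/-- The underlying resolution of an injective resolution. -/
def toResolution (E : InjectiveResolution M) : Resolution M where
  __ := E

theorem nonempty_toResolution_cohomology_equiv (E : InjectiveResolution M) (J : Ideal R) (i : ℕ)
    (n : ℤ) : Nonempty (E.toResolution.cohomology J i n ≃ₗ[k] E.cohomology J i n) := by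
  cases i <;> exact ⟨.refl k _⟩

end InjectiveResolution

theorem Resolution.nonempty_cohomology_equiv_localCohomology [GradedAlgebra 𝒜]
    [IsNoetherianRing R] {M : ZGradedModule 𝒜} (C : Resolution M) {l : List R}
    (hl : ∀ f ∈ l, SetLike.IsHomogeneousElem 𝒜 f) (hC : ∀ i, IsTorsionAcyclic l (C.obj i))
    (i : ℕ) (n : ℤ) :
    Nonempty (C.cohomology (Ideal.ofList l) i n ≃ₗ[k]
      M.localCohomology (Ideal.ofList l) i n) := by
  let E := Classical.choice M.nonempty_injectiveResolution
  obtain ⟨φ⟩ : Nonempty (Hom C E.toResolution) := nonempty_hom E.injective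
  obtain ⟨e₁⟩ := φ.nonempty_cohomology_equiv hl hC
    (fun i => (E.injective i).isTorsionAcyclic hl) i n
  obtain ⟨e₂⟩ := E.nonempty_toResolution_cohomology_equiv (Ideal.ofList l) i n
  exact ⟨e₁.trans e₂⟩

end ZGradedModule

section FlatSubmodule

variable {A : Type*} (S : Type*) [CommRing A] [CommRing S] [Algebra A S]
  {V W : Type*} [AddCommGroup V] [Module A V] [AddCommGroup W] [Module A W]

theorem baseChange_le_iff {p : Submodule A V} {q : Submodule S (S ⊗[A] V)} :
    p.baseChange S ≤ q ↔ ∀ x ∈ p, 1 ⊗ₜ x ∈ q := by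
  rw [Submodule.baseChange_eq_span, Submodule.span_le]
  exact Set.forall_mem_image

theorem submodule_baseChange_map (f : V →ₗ[A] W) (p : Submodule A V) :
    (p.map f).baseChange S = (p.baseChange S).map (f.baseChange S) := by
  refine le_antisymm ((baseChange_le_iff S).2 ?_)
    (Submodule.map_le_iff_le_comap.2 ((baseChange_le_iff S).2 fun x hx =>
      Submodule.tmul_mem_baseChange_of_mem 1 (Submodule.mem_map_of_mem hx)))
  rintro _ ⟨x, hx, rfl⟩
  exact ⟨1 ⊗ₜ x, Submodule.tmul_mem_baseChange_of_mem 1 hx, LinearMap.baseChange_tmul _ _ _⟩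

theorem ker_baseChange_of_surjective {g : V →ₗ[A] W} (hg : Function.Surjective g) :
    LinearMap.ker (g.baseChange S) = (LinearMap.ker g).baseChange S :=
  Submodule.ext (lTensor_exact S (LinearMap.exact_subtype_ker_map g) hg)

theorem ker_baseChange [Module.Flat A S] (g : V →ₗ[A] W) :
    LinearMap.ker (g.baseChange S) = (LinearMap.ker g).baseChange S :=
  Submodule.ext (Module.Flat.lTensor_exact S (LinearMap.exact_subtype_ker_map g))

theorem submodule_baseChange_comap [Module.Flat A S] (f : V →ₗ[A] W) (p : Submodule A W) :
    (p.comap f).baseChange S = (p.baseChange S).comap (f.baseChange S) := by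
  rw [← p.ker_mkQ, ← LinearMap.ker_comp, ← ker_baseChange, LinearMap.baseChange_comp,
    LinearMap.ker_comp, ker_baseChange]

theorem submodule_baseChange_inf [Module.Flat A S] (p q : Submodule A V) :
    (p ⊓ q).baseChange S = p.baseChange S ⊓ q.baseChange S := by
  have hp : p.baseChange S = LinearMap.range (p.subtype.baseChange S) := rfl
  rw [← p.map_comap_subtype q, submodule_baseChange_map, submodule_baseChange_comap,
    Submodule.map_comap_eq, hp]

end FlatSubmodule

section Subquotient

variable {A S k V V' H : Type*} [CommRing A] [CommRing S] [Algebra A S] [CommRing k] [Algebra A k]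
  [AddCommGroup V] [Module A V] [Module k V] [IsScalarTower A k V] [AddCommGroup V'] [Module S V']
  [AddCommGroup H] [Module A H] [Module k H] [IsScalarTower A k H]

theorem nonempty_quotient_equiv_baseChange {Z : Type*} [AddCommGroup Z] [Module A Z]
    {Z' : Type*} [AddCommGroup Z'] [Module S Z'] (e : S ⊗[A] Z ≃ₗ[S] Z') {π : Z →ₗ[A] H}
    (hπ : Function.Surjective π) {B' : Submodule S Z'}
    (hB : B'.comap e.toLinearMap = (LinearMap.ker π).baseChange S) :
    Nonempty ((Z' ⧸ B') ≃ₗ[S] S ⊗[A] H) := by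
  have hsurj : Function.Surjective (π.baseChange S) := LinearMap.lTensor_surjective S hπ
  refine ⟨(Submodule.Quotient.equiv _ B' e ?_).symm.trans
    ((π.baseChange S).quotKerEquivOfSurjective hsurj)⟩
  rw [ker_baseChange_of_surjective S hπ, ← hB]
  exact Submodule.map_comap_eq_of_surjective e.surjective B'

theorem nonempty_subquotient_baseChange_equiv [Module.Flat A S] (τ : S ⊗[A] V ≃ₗ[S] V')
    {Z B : Submodule k V} {Z' B' : Submodule S V'}
    (hZ : Z'.comap τ.toLinearMap = (Z.restrictScalars A).baseChange S)
    (hB : B'.comap τ.toLinearMap = (B.restrictScalars A).baseChange S)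
    (e : (Z ⧸ B.submoduleOf Z) ≃ₗ[k] H) :
    Nonempty ((Z' ⧸ B'.submoduleOf Z') ≃ₗ[S] S ⊗[A] H) := by
  let P : Submodule A V := Z.restrictScalars A
  let π : P →ₗ[A] H :=
    (e.toLinearMap ∘ₗ (B.submoduleOf Z).mkQ : Z →ₗ[k] H).restrictScalars A
  have hπ : Function.Surjective π := e.surjective.comp (B.submoduleOf Z).mkQ_surjective
  have hker : LinearMap.ker π = (B.restrictScalars A).comap P.subtype :=
    Submodule.ext fun z => e.map_eq_zero_iff.trans (Submodule.Quotient.mk_eq_zero _)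
  have hmap : (P.baseChange S).map τ.toLinearMap = Z' := by
    rw [← hZ]
    exact Submodule.map_comap_eq_of_surjective τ.surjective Z'
  refine nonempty_quotient_equiv_baseChange
    ((Submodule.toBaseChange.toLinearEquiv S P).trans (τ.ofSubmodules _ _ hmap)) hπ ?_
  rw [hker, submodule_baseChange_comap, ← hB]
  rfl

end Subquotient

theorem exists_list_homogeneous_ofList_eq {ι σ R : Type*} [CommRing R] [SetLike σ R]
    [AddSubmonoidClass σ R] [DecidableEq ι] [AddMonoid ι] {𝒜 : ι → σ} [GradedRing 𝒜]
    {J : Ideal R} (hJ : J.IsHomogeneous 𝒜) (hfg : J.FG) :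
    ∃ l : List R, (∀ f ∈ l, SetLike.IsHomogeneousElem 𝒜 f) ∧ Ideal.ofList l = J := by
  obtain ⟨s, rfl⟩ := (Ideal.IsHomogeneous.iff_exists 𝒜 J).1 hJ
  obtain ⟨t, ht, hst⟩ := Submodule.fg_span_iff_fg_span_finset_subset _ |>.1 hfg
  refine ⟨t.toList, fun f hf => ?_, ?_⟩
  · obtain ⟨g, -, rfl⟩ := ht (Finset.mem_toList.1 hf)
    exact g.2
  · simpa [Ideal.ofList, Ideal.span] using hst.symm

namespace ZGradedModule

open Algebra.TensorProduct (includeRight)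

variable {k R : Type u} [CommRing k] [CommRing R] [Algebra k R]
  (A : Type u) [CommRing A] [Algebra A k] [Algebra A R] [IsScalarTower A k R]
  (S : Type u) [CommRing S] [Algebra A S] {𝒜 : ℕ → Submodule k R}

section Module

variable (X : ZGradedModule 𝒜) [Module A X] [IsScalarTower A k X]

/-- The identity of `S ⊗[A] X`, regarded as a map to the graded module `X.baseChange A S`, whose
`S ⊗[A] R`-module structure is not an instance on `S ⊗[A] X`. -/
noncomputable def baseChangeEquiv : S ⊗[A] X ≃ₗ[S] X.baseChange A S :=
  LinearEquiv.refl S (S ⊗[A] X)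

theorem tmul_smul_baseChangeEquiv_tmul (s t : S) (r : R) (x : X) :
    (s ⊗ₜ[A] r : S ⊗[A] R) • X.baseChangeEquiv A S (t ⊗ₜ x) =
      X.baseChangeEquiv A S ((s * t) ⊗ₜ (r • x)) := rfl

theorem includeRight_smul_baseChangeEquiv_one_tmul (r : R) (x : X) :
    (includeRight r : S ⊗[A] R) • X.baseChangeEquiv A S (1 ⊗ₜ x) =
      X.baseChangeEquiv A S (1 ⊗ₜ (r • x)) := by
  rw [Algebra.TensorProduct.includeRight_apply, tmul_smul_baseChangeEquiv_tmul, one_mul]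

theorem includeRight_smul_baseChangeEquiv (r : R) (z : S ⊗[A] X) :
    (includeRight r : S ⊗[A] R) • X.baseChangeEquiv A S z = X.baseChangeEquiv A S
      (((Module.toModuleEnd k (S := R) X r).restrictScalars A).baseChange S z) := by
  induction z using TensorProduct.induction_on with
  | zero => simp only [map_zero, smul_zero]
  | add x y hx hy => rw [map_add, smul_add, hx, hy, map_add, map_add]
  | tmul s x =>
    rw [Algebra.TensorProduct.includeRight_apply, tmul_smul_baseChangeEquiv_tmul, one_mul]
    rfl

theorem baseChangeEquiv_mem_deg_iff {n : ℤ} {z : S ⊗[A] X} :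
    X.baseChangeEquiv A S z ∈ (X.baseChange A S).deg n ↔
      z ∈ ((X.deg n).restrictScalars A).baseChange S := Iff.rfl

theorem baseChangeEquiv_mem_of_forall_one_tmul {p : Submodule A X}
    {q : Submodule (S ⊗[A] R) (X.baseChange A S)}
    (h : ∀ x ∈ p, X.baseChangeEquiv A S (1 ⊗ₜ x) ∈ q) {z : S ⊗[A] X} (hz : z ∈ p.baseChange S) :
    X.baseChangeEquiv A S z ∈ q := by
  have hle : p.baseChange S ≤
      (q.restrictScalars S).comap (X.baseChangeEquiv A S).toLinearMap :=
    (baseChange_le_iff S).2 h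
  exact hle hz

section Torsion

variable [Module.Flat A S] {l : List R}

theorem baseChangeEquiv_mem_powTorsion_singleton_iff {f : R} {z : S ⊗[A] X} :
    X.baseChangeEquiv A S z ∈
        powTorsion [(includeRight f : S ⊗[A] R)] (X.baseChange A S) ↔
      z ∈ (((powTorsion [f] X).restrictScalars k).restrictScalars A).baseChange S := by
  refine ⟨fun hz => ?_,
    baseChangeEquiv_mem_of_forall_one_tmul A S X fun x hx => mem_powTorsion_singleton.2 ?_⟩
  · obtain ⟨t, ht⟩ := mem_powTorsion_singleton.1 hz
    rw [← map_pow, includeRight_smul_baseChangeEquiv] at ht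
    have hker := (X.baseChangeEquiv A S).injective (ht.trans (map_zero _).symm)
    rw [← LinearMap.mem_ker, ker_baseChange] at hker
    refine Submodule.baseChange_mono S (fun x hx => ?_) hker
    exact mem_powTorsion_singleton.2 ⟨t, hx⟩
  · obtain ⟨t, ht⟩ := mem_powTorsion_singleton.1 hx
    refine ⟨t, ?_⟩
    rw [← map_pow, includeRight_smul_baseChangeEquiv_one_tmul, ht, TensorProduct.tmul_zero,
      map_zero]

theorem baseChangeEquiv_mem_powTorsion_iff {z : S ⊗[A] X} :
    X.baseChangeEquiv A S z ∈
        powTorsion (l.map (includeRight : R →ₐ[A] S ⊗[A] R)) (X.baseChange A S) ↔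
      z ∈ (((powTorsion l X).restrictScalars k).restrictScalars A).baseChange S := by
  induction l with
  | nil => simp [powTorsion]
  | cons f l ih =>
    have hcons : ((powTorsion (f :: l) X).restrictScalars k).restrictScalars A =
        ((powTorsion [f] X).restrictScalars k).restrictScalars A ⊓
          ((powTorsion l X).restrictScalars k).restrictScalars A := by
      rw [powTorsion_cons]
      rfl
    rw [hcons, submodule_baseChange_inf, Submodule.mem_inf, List.map_cons, powTorsion_cons,
      Submodule.mem_inf, ih, baseChangeEquiv_mem_powTorsion_singleton_iff]

theorem baseChangeEquiv_mem_torsionDeg_iff {n : ℤ} {z : S ⊗[A] X} :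
    X.baseChangeEquiv A S z ∈ torsionDeg
        ((Ideal.ofList l).map (includeRight : R →ₐ[A] S ⊗[A] R)) (X.baseChange A S) n ↔
      z ∈ ((torsionDeg (Ideal.ofList l) X n).restrictScalars A).baseChange S := by
  have h : (torsionDeg (Ideal.ofList l) X n).restrictScalars A =
      (X.deg n).restrictScalars A ⊓
        ((powTorsion l X).restrictScalars k).restrictScalars A :=
    Submodule.ext fun x => mem_torsionDeg_ofList
  have hmap : (Ideal.ofList l).map (includeRight : R →ₐ[A] S ⊗[A] R) =
      Ideal.ofList (l.map (includeRight : R →ₐ[A] S ⊗[A] R)) := Ideal.map_ofList _ l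
  rw [h, submodule_baseChange_inf, hmap, mem_torsionDeg_ofList, baseChangeEquiv_mem_deg_iff,
    baseChangeEquiv_mem_powTorsion_iff, Submodule.mem_inf]

open scoped Pointwise in
theorem isTorsionAcyclic_baseChange (h : IsTorsionAcyclic l X) :
    IsTorsionAcyclic (l.map (includeRight : R →ₐ[A] S ⊗[A] R)) (X.baseChange A S) := by
  induction l with
  | nil => trivial
  | cons f l ih =>
    refine ⟨ih h.1, fun z hz => ?_⟩
    obtain ⟨z, rfl⟩ := (X.baseChangeEquiv A S).surjective z
    refine baseChangeEquiv_mem_of_forall_one_tmul A S X (fun x hx => ?_)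
      ((baseChangeEquiv_mem_powTorsion_iff A S X).1 hz)
    obtain ⟨y, hy, hxy⟩ := mem_smul_sup_powTorsion_iff.1 (h.2 hx)
    refine mem_smul_sup_powTorsion_iff.2 ⟨X.baseChangeEquiv A S (1 ⊗ₜ y),
      (baseChangeEquiv_mem_powTorsion_iff A S X).2
        (Submodule.tmul_mem_baseChange_of_mem 1 hy), ?_⟩
    rw [includeRight_smul_baseChangeEquiv_one_tmul, ← map_sub, ← TensorProduct.tmul_sub]
    exact (baseChangeEquiv_mem_powTorsion_singleton_iff A S X).2
      (Submodule.tmul_mem_baseChange_of_mem 1 hxy)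

end Torsion

end Module

section Map

variable {X Y Z : ZGradedModule 𝒜} [Module A X] [IsScalarTower A k X] [Module A Y]
  [IsScalarTower A k Y] [Module A Z] [IsScalarTower A k Z]

/-- A map of graded modules as a map over `A`. The restriction is done in two steps because only
the scalar towers over `A` and `k` and over `k` and `R` are instances. -/
def restrictBase (f : X →ₗ[R] Y) : X →ₗ[A] Y := (f.restrictScalars k).restrictScalars A

/-- The base change of a map of graded modules. -/
noncomputable def baseChangeMap (f : X →ₗ[R] Y) :
    X.baseChange A S →ₗ[S ⊗[A] R] Y.baseChange A S where
  __ := (Y.baseChangeEquiv A S).toLinearMap ∘ₗ (restrictBase A f).baseChange S ∘ₗ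
    (X.baseChangeEquiv A S).symm.toLinearMap
  map_smul' r x := by
    obtain ⟨x, rfl⟩ := (X.baseChangeEquiv A S).surjective x
    change Y.baseChangeEquiv A S ((restrictBase A f).baseChange S
        ((X.baseChangeEquiv A S).symm (r • X.baseChangeEquiv A S x))) =
      r • Y.baseChangeEquiv A S ((restrictBase A f).baseChange S x)
    induction r using TensorProduct.induction_on with
    | zero => simp only [zero_smul, map_zero]
    | add r s hr hs => simp only [add_smul, map_add, hr, hs]
    | tmul s r =>
      induction x using TensorProduct.induction_on with
      | zero => simp only [map_zero, smul_zero]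
      | add x y hx hy => simp only [map_add, smul_add, hx, hy]
      | tmul t x =>
        simp only [tmul_smul_baseChangeEquiv_tmul, LinearEquiv.symm_apply_apply,
          LinearMap.baseChange_tmul]
        congr 2
        exact map_smul f r x

theorem baseChangeMap_baseChangeEquiv (f : X →ₗ[R] Y) (z : S ⊗[A] X) :
    baseChangeMap A S f (X.baseChangeEquiv A S z) =
      Y.baseChangeEquiv A S ((restrictBase A f).baseChange S z) := rfl

theorem IsGradedMap.baseChangeMap {f : X →ₗ[R] Y} (hf : IsGradedMap f) :
    IsGradedMap (baseChangeMap A S f) := by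
  intro n x hx
  obtain ⟨z, rfl⟩ := (X.baseChangeEquiv A S).surjective x
  have hle : ((X.deg n).restrictScalars A).baseChange S ≤
      (((Y.deg n).restrictScalars A).baseChange S).comap ((restrictBase A f).baseChange S) :=
    (baseChange_le_iff S).2 fun x hx => Submodule.tmul_mem_baseChange_of_mem 1 (hf n x hx)
  rw [baseChangeMap_baseChangeEquiv]
  exact hle hx

theorem baseChangeMap_injective [Module.Flat A S] {f : X →ₗ[R] Y} (hf : Function.Injective f) :
    Function.Injective (baseChangeMap A S f) :=
  Module.Flat.lTensor_preserves_injective_linearMap (restrictBase A f) hf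

theorem exact_baseChangeMap [Module.Flat A S] {f : X →ₗ[R] Y} {g : Y →ₗ[R] Z}
    (h : Function.Exact f g) : Function.Exact (baseChangeMap A S f) (baseChangeMap A S g) :=
  Module.Flat.lTensor_exact S (f := restrictBase A f) (g := restrictBase A g) h

end Map

namespace Resolution

variable [Module.Flat A S] {M : ZGradedModule 𝒜} [Module A M] [IsScalarTower A k M]
  (C : Resolution M) [∀ i, Module A (C.obj i)] [∀ i, IsScalarTower A k (C.obj i)]

/-- The base change of a resolution along a flat homomorphism. -/
noncomputable def baseChange : Resolution (M.baseChange A S) where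
  obj i := (C.obj i).baseChange A S
  ι := baseChangeMap A S C.ι
  ι_graded := C.ι_graded.baseChangeMap A S
  ι_injective := baseChangeMap_injective A S C.ι_injective
  d i := baseChangeMap A S (C.d i)
  d_graded i := (C.d_graded i).baseChangeMap A S
  exact_zero := exact_baseChangeMap A S C.exact_zero
  exact_succ i := exact_baseChangeMap A S (C.exact_succ i)

variable (l : List R) (i : ℕ) (n : ℤ)

theorem comap_cocycles_baseChange :
    ((C.baseChange A S).cocycles
        ((Ideal.ofList l).map (includeRight : R →ₐ[A] S ⊗[A] R)) i n).comap
      ((C.obj i).baseChangeEquiv A S).toLinearMap =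
    ((C.cocycles (Ideal.ofList l) i n).restrictScalars A).baseChange S := by
  have h : (C.cocycles (Ideal.ofList l) i n).restrictScalars A =
      (torsionDeg (Ideal.ofList l) (C.obj i) n).restrictScalars A ⊓
        LinearMap.ker (restrictBase A (C.d i)) := rfl
  rw [h, submodule_baseChange_inf, ← ker_baseChange]
  ext z
  exact and_congr_left' (baseChangeEquiv_mem_torsionDeg_iff A S (C.obj i))

theorem comap_coboundaries_baseChange :
    ((C.baseChange A S).coboundaries
        ((Ideal.ofList l).map (includeRight : R →ₐ[A] S ⊗[A] R)) i n).comap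
      ((C.obj i).baseChangeEquiv A S).toLinearMap =
    ((C.coboundaries (Ideal.ofList l) i n).restrictScalars A).baseChange S := by
  cases i with
  | zero =>
    have h : (C.coboundaries (Ideal.ofList l) 0 n).restrictScalars A = ⊥ := rfl
    rw [h, Submodule.baseChange_bot]
    exact ((C.obj 0).baseChangeEquiv A S).ker
  | succ i =>
    have h : (C.coboundaries (Ideal.ofList l) (i + 1) n).restrictScalars A =
        ((torsionDeg (Ideal.ofList l) (C.obj i) n).restrictScalars A).map
          (restrictBase A (C.d i)) := rfl
    rw [h, submodule_baseChange_map]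
    ext z
    constructor
    · rintro ⟨x, hx, hxz⟩
      obtain ⟨x, rfl⟩ := ((C.obj i).baseChangeEquiv A S).surjective x
      exact ⟨x, (baseChangeEquiv_mem_torsionDeg_iff A S (C.obj i)).1 hx,
        ((C.obj (i + 1)).baseChangeEquiv A S).injective hxz⟩
    · rintro ⟨x, hx, rfl⟩
      exact ⟨(C.obj i).baseChangeEquiv A S x,
        (baseChangeEquiv_mem_torsionDeg_iff A S (C.obj i)).2 hx, rfl⟩

end Resolution

theorem nonempty_localCohomology_baseChange_equiv [Module.Flat A S] [GradedAlgebra 𝒜]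
    [IsNoetherianRing R] [IsNoetherianRing (S ⊗[A] R)] {J : Ideal R} (hJ : J.IsHomogeneous 𝒜)
    (M : ZGradedModule 𝒜) [Module A M] [IsScalarTower A k M] (i : ℕ) (n : ℤ)
    [Module A (M.localCohomology J i n)] [IsScalarTower A k (M.localCohomology J i n)] :
    Nonempty ((M.baseChange A S).localCohomology
        (J.map (includeRight : R →ₐ[A] S ⊗[A] R)) i n ≃ₗ[S]
      S ⊗[A] M.localCohomology J i n) := by
  obtain ⟨l, hl, rfl⟩ := exists_list_homogeneous_ofList_eq hJ (IsNoetherian.noetherian J)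
  let E := Classical.choice M.nonempty_injectiveResolution
  let C := E.toResolution
  let _ (j : ℕ) : Module A (C.obj j) := Module.compHom _ (algebraMap A k)
  have (j : ℕ) : IsScalarTower A k (C.obj j) := .of_algebraMap_smul fun _ _ => rfl
  have hC (j : ℕ) : IsTorsionAcyclic l (C.obj j) := (E.injective j).isTorsionAcyclic hl
  have hmap : (Ideal.ofList l).map (includeRight : R →ₐ[A] S ⊗[A] R) =
      Ideal.ofList (l.map (includeRight : R →ₐ[A] S ⊗[A] R)) := Ideal.map_ofList _ l
  have hl' : ∀ f ∈ l.map (includeRight : R →ₐ[A] S ⊗[A] R),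
      SetLike.IsHomogeneousElem (baseChangeGrading A S 𝒜) f := by
    simp only [List.forall_mem_map]
    intro f hf
    obtain ⟨a, ha⟩ := hl f hf
    exact ⟨a, Submodule.tmul_mem_baseChange_of_mem 1 ha⟩
  obtain ⟨e⟩ := C.nonempty_cohomology_equiv_localCohomology hl hC i n
  obtain ⟨e'⟩ := (C.baseChange A S).nonempty_cohomology_equiv_localCohomology hl'
    (fun j => isTorsionAcyclic_baseChange A S (C.obj j) (hC j)) i n
  obtain ⟨e''⟩ := nonempty_subquotient_baseChange_equiv ((C.obj i).baseChangeEquiv A S)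
    (C.comap_cocycles_baseChange A S l i n) (C.comap_coboundaries_baseChange A S l i n) e
  rw [hmap] at e'' ⊢
  exact ⟨e'.symm.trans e''⟩

end ZGradedModule

section Multiplicity

theorem hilbertSamuelMultiplicity_congr {A B : Type*} [CommRing A] [CommRing B] {q : Ideal A}
    {q' : Ideal B} {T T' : Type*} [AddCommGroup T] [Module A T] [AddCommGroup T'] [Module B T']
    (h : ∀ m : ℕ, Module.length A (T ⧸ (q ^ (m + 1) • ⊤ : Submodule A T)) =
      Module.length B (T' ⧸ (q' ^ (m + 1) • ⊤ : Submodule B T'))) :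
    hilbertSamuelMultiplicity q T = hilbertSamuelMultiplicity q' T' := by
  have hP : IsHilbertSamuelPolynomial q T = IsHilbertSamuelPolynomial q' T' := by
    funext P
    simp only [IsHilbertSamuelPolynomial, h]
  unfold hilbertSamuelMultiplicity
  rw [hP]

theorem hilbertSamuelMultiplicity_eq_of_linearEquiv {A : Type*} [CommRing A] (q : Ideal A)
    {T T' : Type*} [AddCommGroup T] [Module A T] [AddCommGroup T'] [Module A T']
    (e : T ≃ₗ[A] T') : hilbertSamuelMultiplicity q T = hilbertSamuelMultiplicity q T' := by
  refine hilbertSamuelMultiplicity_congr fun m => (Submodule.Quotient.equiv _ _ e ?_).length_eq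
  rw [Submodule.map_smul'', Submodule.map_top, LinearEquiv.range]

theorem hilbertSamuelMultiplicity_comap_of_surjective {A k : Type*} [CommRing A] [CommRing k]
    [Algebra A k] (hk : Function.Surjective (algebraMap A k)) (q : Ideal k) (T : Type*)
    [AddCommGroup T] [Module A T] [Module k T] [IsScalarTower A k T] :
    hilbertSamuelMultiplicity (q.comap (algebraMap A k)) T = hilbertSamuelMultiplicity q T := by
  refine hilbertSamuelMultiplicity_congr fun m => ?_
  have h : (q.comap (algebraMap A k) ^ (m + 1) • ⊤ : Submodule A T) =
      (q ^ (m + 1) • ⊤ : Submodule k T).restrictScalars A := by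
    conv_rhs => rw [← Ideal.map_comap_of_surjective _ hk q, ← Ideal.map_pow]
    rw [Ideal.smul_restrictScalars, Submodule.restrictScalars_top]
  rw [h, (Submodule.Quotient.restrictScalarsEquiv A _).length_eq, Module.length_eq_of_surjective hk]

variable {A : Type*} (S : Type*) [CommRing A] [CommRing S] [Algebra A S]
  (T : Type*) [AddCommGroup T] [Module A T]

theorem baseChange_ideal_smul_top (I : Ideal A) :
    (I • ⊤ : Submodule A T).baseChange S =
      I.map (algebraMap A S) • (⊤ : Submodule S (S ⊗[A] T)) := by
  apply le_antisymm
  · refine (baseChange_le_iff S).2 fun x hx => Submodule.smul_induction_on hx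
      (fun a ha t _ => ?_) fun x y hx hy => ?_
    · rw [TensorProduct.tmul_smul, ← algebraMap_smul S a]
      exact Submodule.smul_mem_smul (Ideal.mem_map_of_mem _ ha) Submodule.mem_top
    · rw [TensorProduct.tmul_add]
      exact add_mem hx hy
  · suffices I.map (algebraMap A S) ≤ ((I • ⊤ : Submodule A T).baseChange S).colon Set.univ from
      Submodule.smul_le.2 fun c hc z _ => Submodule.mem_colon.1 (this hc) z trivial
    refine Ideal.map_le_iff_le_comap.2 fun a ha => Submodule.mem_colon.2 fun z _ => ?_
    induction z using TensorProduct.induction_on with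
    | zero => rw [smul_zero]; exact zero_mem _
    | add x y hx hy => rw [smul_add]; exact add_mem (hx trivial) (hy trivial)
    | tmul s t =>
      rw [algebraMap_smul, ← TensorProduct.tmul_smul]
      exact Submodule.tmul_mem_baseChange_of_mem s (Submodule.smul_mem_smul ha Submodule.mem_top)

variable [IsLocalRing A] [IsLocalRing S] [Module.Flat A S]

theorem length_baseChange_of_map_maximalIdeal_eq
    (hS : (IsLocalRing.maximalIdeal A).map (algebraMap A S) = IsLocalRing.maximalIdeal S) :
    Module.length S (S ⊗[A] T) = Module.length A T := by
  have : IsLocalHom (algebraMap A S) :=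
    ((IsLocalRing.local_hom_TFAE (algebraMap A S)).out 0 2).2 hS.le
  have : IsSimpleModule S (S ⧸ IsLocalRing.maximalIdeal S) :=
    isSimpleModule_iff_quot_maximal.2 ⟨_, inferInstance, ⟨.refl _ _⟩⟩
  rw [IsLocalRing.length_baseChange, hS, Module.length_eq_one S (S ⧸ _), mul_one]

theorem hilbertSamuelMultiplicity_baseChange
    (hS : (IsLocalRing.maximalIdeal A).map (algebraMap A S) = IsLocalRing.maximalIdeal S)
    (q : Ideal A) :
    hilbertSamuelMultiplicity (q.map (algebraMap A S)) (S ⊗[A] T) =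
      hilbertSamuelMultiplicity q T := by
  refine hilbertSamuelMultiplicity_congr fun m => ?_
  let π := (q ^ (m + 1) • ⊤ : Submodule A T).mkQ
  have hπ : Function.Surjective π := Submodule.mkQ_surjective _
  have hker : (q.map (algebraMap A S) ^ (m + 1) • ⊤ : Submodule S (S ⊗[A] T)) =
      LinearMap.ker (π.baseChange S) := by
    rw [ker_baseChange_of_surjective S hπ, Submodule.ker_mkQ, baseChange_ideal_smul_top,
      Ideal.map_pow]
  rw [hker, ((π.baseChange S).quotKerEquivOfSurjective
    (LinearMap.lTensor_surjective S hπ)).length_eq, length_baseChange_of_map_maximalIdeal_eq S _ hS]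

end Multiplicity

theorem finiteType_of_surjective_of_adjoin_eq_top {k R : Type*} [CommRing k] [CommRing R]
    [IsNoetherianRing R] [Algebra k R] (𝒜 : ℕ → Submodule k R) [GradedAlgebra 𝒜]
    (h₀ : Function.Surjective (algebraMap k (𝒜 0)))
    (h₁ : Algebra.adjoin k (𝒜 1 : Set R) = ⊤) : Algebra.FiniteType k R := by
  obtain ⟨t, ht, hspan⟩ := Submodule.fg_span_iff_fg_span_finset_subset
    (𝒜 1 : Set R) |>.1 (IsNoetherian.noetherian (Ideal.span (𝒜 1 : Set R)))
  refine ⟨⟨t, ?_⟩⟩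
  rw [eq_top_iff, ← h₁, Algebra.adjoin_le_iff]
  intro x hx
  have hxt : x ∈ Ideal.span (t : Set R) := by
    rw [Ideal.span, ← hspan]
    exact Submodule.subset_span hx
  obtain ⟨c, -, hc⟩ := Submodule.mem_span_finset.1 hxt
  -- Only the degree-zero parts of the coefficients contribute, as `x` and `t` have degree one.
  have hdeg : x = ∑ f ∈ t, (DirectSum.decompose 𝒜 (c f) 0 : R) * f := by
    rw [← DirectSum.decompose_of_mem_same 𝒜 hx, ← hc, DirectSum.decompose_sum, DirectSum.sum_apply,
      AddSubmonoidClass.coe_finsetSum]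
    exact Finset.sum_congr rfl fun f hf =>
      DirectSum.coe_decompose_mul_add_of_right_mem 𝒜 (i := 0) (ht hf)
  rw [hdeg]
  refine sum_mem fun f hf => mul_mem ?_ (Algebra.subset_adjoin hf)
  obtain ⟨a, ha⟩ := h₀ (DirectSum.decompose 𝒜 (c f) 0)
  rw [← ha]
  exact Subalgebra.algebraMap_mem _ a

theorem mainTheorem4_general
    {R₀ R₀' R₀'' R : Type u}
    [CommRing R₀]
    [CommRing R₀'] [IsLocalRing R₀'] [IsNoetherianRing R₀']
    [CommRing R₀''] [IsLocalRing R₀''] [IsNoetherianRing R₀'']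
    [Algebra R₀' R₀] (hf : Function.Surjective (algebraMap R₀' R₀))
    [Algebra R₀' R₀''] [Module.Flat R₀' R₀'']
    (hg : (IsLocalRing.maximalIdeal R₀').map (algebraMap R₀' R₀'') =
      IsLocalRing.maximalIdeal R₀'')
    [CommRing R] [Algebra R₀ R] [Algebra.FiniteType R₀ R]
    [Algebra R₀' R] [IsScalarTower R₀' R₀ R]
    (𝒜 : ℕ → Submodule R₀ R) [GradedAlgebra 𝒜]
    {J : Ideal R} (hJ : J.IsHomogeneous 𝒜) (q₀ : Ideal R₀)
    (M : ZGradedModule 𝒜) [Module R₀' M] [IsScalarTower R₀' R₀ M]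
    (i : ℕ) (n : ℤ) :
    hilbertSamuelMultiplicity q₀ (M.localCohomology J i n) =
      hilbertSamuelMultiplicity
        ((q₀.comap (algebraMap R₀' R₀)).map (algebraMap R₀' R₀''))
        ((M.baseChange R₀' R₀'').localCohomology
          (J.map (Algebra.TensorProduct.includeRight : R →ₐ[R₀'] R₀'' ⊗[R₀'] R)) i n) := by
  have : Algebra.FiniteType R₀' R₀ := .of_surjective (Algebra.ofId R₀' R₀) hf
  have : Algebra.FiniteType R₀' R := .trans this ‹Algebra.FiniteType R₀ R›
  have : IsNoetherianRing R := Algebra.FiniteType.isNoetherianRing R₀' R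
  have : IsNoetherianRing (R₀'' ⊗[R₀'] R) := Algebra.FiniteType.isNoetherianRing R₀'' _
  let _ : Module R₀' (M.localCohomology J i n) := Module.compHom _ (algebraMap R₀' R₀)
  have : IsScalarTower R₀' R₀ (M.localCohomology J i n) := .of_algebraMap_smul fun _ _ => rfl
  obtain ⟨e⟩ := ZGradedModule.nonempty_localCohomology_baseChange_equiv R₀' R₀'' hJ M i n
  rw [hilbertSamuelMultiplicity_eq_of_linearEquiv _ e,
    hilbertSamuelMultiplicity_baseChange R₀'' _ hg,
    hilbertSamuelMultiplicity_comap_of_surjective hf]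

theorem mainTheorem4
    {R₀ R₀' R₀'' R : Type u}
    [CommRing R₀] [IsLocalRing R₀] [IsNoetherianRing R₀]
    [CommRing R₀'] [IsLocalRing R₀'] [IsNoetherianRing R₀']
    [CommRing R₀''] [IsLocalRing R₀''] [IsNoetherianRing R₀'']
    [Algebra R₀' R₀] (hf : Function.Surjective (algebraMap R₀' R₀))
    [Algebra R₀' R₀''] [Module.Flat R₀' R₀'']
    (hg : (IsLocalRing.maximalIdeal R₀').map (algebraMap R₀' R₀'') =
      IsLocalRing.maximalIdeal R₀'')
    [CommRing R] [IsNoetherianRing R] [Algebra R₀ R]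
    [Algebra R₀' R] [IsScalarTower R₀' R₀ R]
    (𝒜 : ℕ → Submodule R₀ R) [GradedAlgebra 𝒜]
    (h𝒜₀ : Function.Bijective (algebraMap R₀ (𝒜 0)))
    (h𝒜₁ : Algebra.adjoin R₀ (𝒜 1 : Set R) = ⊤)
    (q₀ : Ideal R₀) (hq₀ : q₀.IsPrimary ∧ q₀.radical = IsLocalRing.maximalIdeal R₀)
    (M : ZGradedModule 𝒜) [Module.Finite R M] [Module R₀' M] [IsScalarTower R₀' R₀ M]
    (i : ℕ) (n : ℤ) :
    hilbertSamuelMultiplicity q₀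
        (M.localCohomology (HomogeneousIdeal.irrelevant 𝒜).toIdeal i n) =
      hilbertSamuelMultiplicity
        ((q₀.comap (algebraMap R₀' R₀)).map (algebraMap R₀' R₀''))
        ((M.baseChange R₀' R₀'').localCohomology
          ((HomogeneousIdeal.irrelevant 𝒜).toIdeal.map
            (Algebra.TensorProduct.includeRight : R →ₐ[R₀'] R₀'' ⊗[R₀'] R)) i n) :=
  have := finiteType_of_surjective_of_adjoin_eq_top 𝒜 h𝒜₀.2 h𝒜₁
  mainTheorem4_general hf hg 𝒜 (HomogeneousIdeal.irrelevant 𝒜).isHomogeneous q₀ M i n
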